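/- **Conventions.** All spaces are real. $\mathfrak p$ is the least cardinality of a family $\mathcal B$ of subsets of $\omega$ such that all finite subfamilies of $\mathcal B$ have infinite intersection but no infinite $S\subseteq\omega$ satisfies $|S\setminus B|<\infty$ for all $B\in\mathcal B$; $\mathfrak c$ is the cardinality of the continuum. For a discrete set $\iota$, $\mathbb A(\iota)=\iota\cup\{\infty\}$ is its one-point compactification. For compact $K$, $M(K)=C(K)^*$ and $M_1(K)$ is its closed unit ball with the weak* topology. Let $|\iota|=\mathfrak c$; write $c_0(\mathfrak c)=c_0(\iota)$, and put $\sigma_\xi=\tfrac12(\delta_\xi-\delta_\infty)\in M_1(\mathbb A(\iota))$ for $\xi\in\iota$. **The construction.** For an almost disjoint family $\mathcal A=\{A_\xi^i:\xi\in\iota,\ i=0,1,2\}$ of infinite subsets of $\omega$ (distinct indices giving sets with finite intersection), let $K_{\mathcal A}=\omega\cup\{x(A):A\in\mathcal A\}\cup\{\infty\}$ be the compact space in which the points of $\omega$ are isolated, the basic neighbourhoods of $x(A)$ are the sets $\{x(A)\}\cup(A\setminus F)$ with $F$ finite, and $\infty$ is the point at infinity of the one-point compactification of the rest. Each $\mu\in\ell_1$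 is regarded as the measure $\sum_n\mu(n)\delta_n\in M(K_{\mathcal A})$. Call $\mathcal A$ *admissible* if for every $0<c<1$, every sequence $(\mu_k)$ in the unit ball of $\ell_1$ with $|\mu_k(\{k\})|\ge c$ for all $k$, and every sequence $(\lambda_k)$ in $M_1(\mathbb A(\iota))$, there is an infinite $N\subseteq\omega$ such that $(\lambda_k)_{k\in N}$ is weak* convergent and the weak* closure of $\{\mu_k:k\in N\}$ in $M(K_{\mathcal A})$ contains, for some $\xi\in\iota$, three measures $d\,\delta_{x(A_\xi^i)}+\nu_i$ $(i=0,1,2)$ with $|d|\ge c$ and $\|\nu_i-\nu_j\|\le c/2$ for all $i,j$. Given such $\mathcal A$, let $L=M_1(\mathbb A(\iota))\cup\omega$ be the quotient of the disjoint union of $M_1(\mathbb A(\iota))$ and $K_{\mathcal A}$ obtained by identifying $x(A_\xi^1)$ with $\sigma_\xi$, $x(A_\xi^2)$ with $-\sigma_\xi$, and $x(A_\xi^0)$ and the point $\infty\in K_{\mathcal A}$ with $0$. Put $$X(\mathfrak c)=\{f\in C(L): \exists\, g\in C(\mathbb A(\iota))\ \ f(\mu)=\mu(g)\ \text{ for all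 } \mu\in M_1(\mathbb A(\iota))\},$$ with the norm of $C(L)$. Let $c_0\to X(\mathfrak c)$ be extension by $0$ on $M_1(\mathbb A(\iota))$, and let $q:X(\mathfrak c)\to c_0(\mathfrak c)$ be the map $f\mapsto g$ followed by an isomorphism $C(\mathbb A(\iota))\cong c_0(\mathfrak c)$. **Proposition.** Assume $\mathfrak p=\mathfrak c$. The spaces $C(\mathbb A(\iota))$ and $c_0(\iota)$ are isomorphic, admissible families exist, and for every admissible family and every choice of the isomorphism, $X(\mathfrak c)$ is a Banach space, the sequence $$0\longrightarrow c_0\longrightarrow X(\mathfrak c)\overset{q}{\longrightarrow} c_0(\mathfrak c)\longrightarrow 0$$ is exact, and it is $c_0(\aleph_1)$-singular: there is no subspace $Y\subseteq X(\mathfrak c)$ isomorphic to $c_0(\aleph_1)$ such that $q|_Y$ is an isomorphism of $Y$ onto $q(Y)$. Equivalently, there is no isomorphic embedding $J:c_0(\aleph_1)\to c_0(\mathfrak c)$ admitting a bounded linear operator $E:c_0(\aleph_1)\to X(\mathfrak c)$ with $qE=J$. -/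

import Mathlib

open Cardinal Filter Topology
open scoped ZeroAtInfty

noncomputable section

namespace TwistedSum

/-! ### The pseudointersection number -/

/-- Every finite subfamily of `ℬ` has infinite intersection. -/
def StrongFIP (ℬ : Set (Set ℕ)) : Prop :=
  ∀ F : Finset (Set ℕ), (F : Set (Set ℕ)) ⊆ ℬ → (⋂ B ∈ F, B).Infinite

/-- Some infinite `S ⊆ ℕ` is almost contained in every member of `ℬ`. -/
def HasPseudointersection (ℬ : Set (Set ℕ)) : Prop :=
  ∃ S : Set ℕ, S.Infinite ∧ ∀ B ∈ ℬ, (S \ B).Finite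

/-- The cardinal `𝔭`: the least cardinality of a family of subsets of `ℕ` with the strong finite
intersection property and without an infinite pseudointersection. -/
def pNumber : Cardinal.{0} :=
  sInf {κ | ∃ ℬ : Set (Set ℕ), #ℬ = κ ∧ StrongFIP ℬ ∧ ¬ HasPseudointersection ℬ}

/-! ### Operators, dual spaces and dual unit balls of normed spaces

These abbreviations only fix that `C(K, ℝ)` and its relatives are used as normed spaces. -/

section Normed

variable (E F : Type) [NormedAddCommGroup E] [NormedSpace ℝ E]
  [NormedAddCommGroup F] [NormedSpace ℝ F]

/-- Bounded linear operators. -/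
abbrev Op : Type := E →L[ℝ] F

/-- Isomorphisms of normed spaces (linear homeomorphisms). -/
abbrev Iso : Type := E ≃L[ℝ] F

/-- Linear subspaces. -/
abbrev NSubspace : Type := Submodule ℝ E

/-- The dual space, with its norm. -/
abbrev NDual : Type := StrongDual ℝ E

/-- The dual space, with the weak* topology. -/
abbrev WStarDual : Type := WeakDual ℝ E

variable {E} in
/-- The identity from the dual space to the dual space with the weak* topology. -/
def toWStar (φ : NDual E) : WStarDual E := StrongDual.toWeakDual φ

variable {E} in
@[simp] theorem toWStar_apply (φ : NDual E) (x : E) : toWStar φ x = φ x := rfl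

/-- The closed unit ball of the dual space, with the weak* topology. -/
abbrev DualBall : Type := {φ : WStarDual E // ‖WeakDual.toStrongDual φ‖ ≤ 1}

instance : CompactSpace (DualBall E) := by
  have h := WeakDual.isCompact_closedBall (𝕜 := ℝ) (E := E) 0 1
  have h' : (WeakDual.toStrongDual ⁻¹' Metric.closedBall (0 : StrongDual ℝ E) 1) =
      {φ : WStarDual E | ‖WeakDual.toStrongDual φ‖ ≤ 1} := by
    ext φ; simp
  rw [h'] at h
  exact isCompact_iff_compactSpace.mp h

variable {E} in
/-- An element of norm at most one of the dual space as a point of the dual unit ball. -/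
def ballPoint (φ : NDual E) (h : ‖φ‖ ≤ 1) : DualBall E := ⟨toWStar φ, h⟩

variable {E} in
@[simp] theorem ballPoint_apply (φ : NDual E) (h : ‖φ‖ ≤ 1) (x : E) :
    (ballPoint φ h).1 x = φ x := rfl

end Normed

/-! ### Measures: `M(K) = C(K)*` and its unit ball `M₁(K)` -/

/-- `M(K)`, identified with the dual of `C(K)`. -/
abbrev Meas (K : Type) [TopologicalSpace K] [CompactSpace K] : Type := NDual C(K, ℝ)

/-- `M₁(K)`: the unit ball of `M(K)` with the weak* topology. -/
abbrev MBall (K : Type) [TopologicalSpace K] [CompactSpace K] : Type := DualBall C(K, ℝ)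

section Dirac

variable {K : Type} [TopologicalSpace K] [CompactSpace K]

/-- The Dirac measure `δ_x`. -/
def dirac (x : K) : Meas K := ContinuousMap.evalCLM ℝ x

@[simp] theorem dirac_apply (x : K) (f : C(K, ℝ)) : dirac x f = f x := rfl

theorem norm_dirac_le (x : K) : ‖dirac x‖ ≤ 1 :=
  ContinuousLinearMap.opNorm_le_bound _ zero_le_one fun f => by
    simpa using f.norm_coe_le_norm x

/-- The canonical (weak* continuous) map `K → M₁(K)`, `x ↦ δ_x`. -/
def diracMap : C(K, MBall K) where
  toFun x := ballPoint (dirac x) (norm_dirac_le x)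
  continuous_toFun :=
    Continuous.subtype_mk (WeakDual.continuous_of_continuous_eval fun f => f.continuous) _

end Dirac

/-! ### The Alexandroff-Urysohn compactum of a family of subsets of `ℕ` -/

/-- The locally compact part `ω ∪ {p_j : j ∈ J}` of the Alexandroff-Urysohn space. -/
inductive Psi {J : Type} (A : J → Set ℕ) : Type
  | nat (n : ℕ) : Psi A
  | lim (j : J) : Psi A

/-- Points of `ℕ` are isolated and the basic neighbourhoods of `p_j` are `{p_j} ∪ (A j \ I)` with
`I` finite. -/
instance {J : Type} (A : J → Set ℕ) : TopologicalSpace (Psi A) where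
  IsOpen U := ∀ j, Psi.lim j ∈ U → {n ∈ A j | Psi.nat n ∉ U}.Finite
  isOpen_univ := fun j _ => by simp
  isOpen_inter := fun U V hU hV j hj => by
    refine ((hU j hj.1).union (hV j hj.2)).subset ?_
    rintro n ⟨hn, hn'⟩
    by_cases h : Psi.nat n ∈ U
    · exact Or.inr ⟨hn, fun h' => hn' ⟨h, h'⟩⟩
    · exact Or.inl ⟨hn, h⟩
  isOpen_sUnion := fun S hS j hj => by
    obtain ⟨U, hU, hjU⟩ := hj
    refine (hS U hU j hjU).subset ?_
    rintro n ⟨hn, hn'⟩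
    exact ⟨hn, fun h => hn' ⟨U, hU, h⟩⟩

/-- The Alexandroff-Urysohn compactum `K_𝒜 = ω ∪ {p_j : j ∈ J} ∪ {∞}`. -/
abbrev AUSpace {J : Type} (A : J → Set ℕ) : Type := OnePoint (Psi A)

/-- The isolated point `n` of `K_𝒜`. -/
def natPt {J : Type} (A : J → Set ℕ) (n : ℕ) : AUSpace A :=
  ((Psi.nat n : Psi A) : OnePoint (Psi A))

/-- The point `p_j` of `K_𝒜`: the limit of the set `A j`. -/
def limPt {J : Type} (A : J → Set ℕ) (j : J) : AUSpace A :=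
  ((Psi.lim j : Psi A) : OnePoint (Psi A))

/-! ### Forks and the almost disjoint families of the construction -/

/-- `φ 0, φ 1, φ 2` form a `(c, ε)`-fork at the points `x 0, x 1, x 2` of `K`:
`φ i = d δ_{x i} + ν i` with `|d| ≥ c`, the points `x i` different and `‖ν i - ν j‖ ≤ ε`. -/
def IsForkAt {K : Type} [TopologicalSpace K] [CompactSpace K] (c ε : ℝ) (x : Fin 3 → K)
    (φ : Fin 3 → Meas K) : Prop :=
  Function.Injective x ∧ ∃ (d : ℝ) (ν : Fin 3 → Meas K),
    c ≤ |d| ∧ (∀ i j, ‖ν i - ν j‖ ≤ ε) ∧ ∀ i, φ i = d • dirac (x i) + ν i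

/-- The measure `∑ μ(n) δ_n` on `K_𝒜` given by `μ ∈ ℓ₁` (a norm convergent series in `C(K_𝒜)*`). -/
def ellOneMeasure {J : Type} (A : J → Set ℕ) (μ : lp (fun _ : ℕ => ℝ) 1) :
    Meas (AUSpace A) :=
  ∑' n, μ n • dirac (natPt A n)

/-- The requirements on the family `𝒜 = {A_ξ^i : ξ ∈ ι, i = 0, 1, 2}` from which the twisted sum of
`c₀` and `C(𝔸(ι))`, `𝔸(ι) = OnePoint ι`, is constructed. -/
structure IsAdmissible {ι : Type} [TopologicalSpace ι] (A : ι × Fin 3 → Set ℕ) : Prop where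
  infinite : ∀ j, (A j).Infinite
  almostDisjoint : ∀ j k, j ≠ k → (A j ∩ A k).Finite
  /-- For all `0 < c < 1`, every sequence `(μ_k)` in the unit ball of `ℓ₁` with `|μ_k({k})| ≥ c`
  and every sequence `(lam_k)` in `M₁(𝔸(ι))`, there is an infinite `N ⊆ ω` such that
  `(lam_k)_{k ∈ N}` is weak* convergent and the weak* closure of `{μ_k : k ∈ N}` in `M(K_𝒜)`
  contains a `(c, c/2)`-fork located at the points of `K_𝒜` given by `A_ξ^0, A_ξ^1, A_ξ^2`, for
  some `ξ`. -/
  fork : ∀ c : ℝ, 0 < c → c < 1 → ∀ μ : ℕ → lp (fun _ : ℕ => ℝ) 1,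
    (∀ k, ‖μ k‖ ≤ 1) → (∀ k, c ≤ |μ k k|) →
    ∀ lam : ℕ → MBall (OnePoint ι),
      ∃ N : Set ℕ, N.Infinite ∧ (∃ l, Tendsto lam (atTop ⊓ 𝓟 N) (𝓝 l)) ∧
        ∃ (ξ : ι) (φ : Fin 3 → Meas (AUSpace A)),
          IsForkAt c (c / 2) (fun i => limPt A (ξ, i)) φ ∧
          ∀ i, toWStar (φ i) ∈
            closure ((fun k => toWStar (ellOneMeasure A (μ k))) '' N)

/-! ### The countable discrete extension `L = M₁(𝔸(ι)) ∪ ω` -/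

section Extension

variable {ι : Type} [TopologicalSpace ι]

/-- The measure `(δ_ξ - δ_∞) / 2` on `𝔸(ι)`. -/
def sigma (ξ : ι) : Meas (OnePoint ι) :=
  (1 / 2 : ℝ) • (dirac (ξ : OnePoint ι) - dirac (OnePoint.infty : OnePoint ι))

theorem norm_sigma_le (ξ : ι) : ‖sigma ξ‖ ≤ 1 := by
  refine ContinuousLinearMap.opNorm_le_bound _ zero_le_one fun f => ?_
  have h1 := f.norm_coe_le_norm (ξ : OnePoint ι)
  have h2 := f.norm_coe_le_norm (OnePoint.infty : OnePoint ι)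
  have h3 : sigma ξ f = 1 / 2 * (f (ξ : OnePoint ι) - f (OnePoint.infty : OnePoint ι)) := rfl
  rw [Real.norm_eq_abs, abs_le] at h1 h2
  rw [h3, Real.norm_eq_abs, abs_le]
  constructor <;> linarith [h1.1, h1.2, h2.1, h2.2]

/-- `σ_ξ` as a point of `M₁(𝔸(ι))`. -/
def sigmaPt (ξ : ι) : MBall (OnePoint ι) := ballPoint (sigma ξ) (norm_sigma_le ξ)

/-- `-σ_ξ` as a point of `M₁(𝔸(ι))`. -/
def negSigmaPt (ξ : ι) : MBall (OnePoint ι) :=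
  ballPoint (-sigma ξ) ((norm_neg (sigma ξ)).trans_le (norm_sigma_le ξ))

/-- `0` as a point of `M₁(𝔸(ι))`. -/
def zeroPt (ι : Type) [TopologicalSpace ι] : MBall (OnePoint ι) :=
  ballPoint 0 (by simp)

/-- The underlying set of `L`: the disjoint union of `M₁(𝔸(ι))` and `ω`. -/
inductive Ext (A : ι × Fin 3 → Set ℕ) : Type
  | ball (m : MBall (OnePoint ι)) : Ext A
  | nat (n : ℕ) : Ext A

/-- The gluing on `ω ∪ {p_A : A ∈ 𝒜}`: `n` stays, and the points of `A_ξ^0`, `A_ξ^1`, `A_ξ^2`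
are identified with `0`, `σ_ξ`, `-σ_ξ`. -/
def gluePsi (A : ι × Fin 3 → Set ℕ) : Psi A → Ext A
  | .nat n => .nat n
  | .lim (ξ, i) => .ball (![zeroPt ι, sigmaPt ξ, negSigmaPt ξ] i)

/-- The gluing map from the disjoint union of `M₁(𝔸(ι))` and `K_𝒜` onto `L`; the point `∞` of `K_𝒜`
is identified with `0`. -/
def glue (A : ι × Fin 3 → Set ℕ) : MBall (OnePoint ι) ⊕ AUSpace A → Ext A :=
  Sum.elim .ball (fun x => x.elim (.ball (zeroPt ι)) (gluePsi A))

/-- `L` carries the quotient topology of the gluing map. -/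
instance (A : ι × Fin 3 → Set ℕ) : TopologicalSpace (Ext A) :=
  TopologicalSpace.coinduced (glue A) inferInstance

theorem continuous_glue (A : ι × Fin 3 → Set ℕ) : Continuous (glue A) :=
  continuous_coinduced_rng

theorem continuous_ball (A : ι × Fin 3 → Set ℕ) : Continuous (Ext.ball : _ → Ext A) :=
  (continuous_glue A).comp continuous_inl

theorem surjective_glue (A : ι × Fin 3 → Set ℕ) : Function.Surjective (glue A) := by
  rintro (m | n)
  · exact ⟨Sum.inl m, rfl⟩
  · exact ⟨Sum.inr (natPt A n), rfl⟩

instance (A : ι × Fin 3 → Set ℕ) : CompactSpace (Ext A) :=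
  (surjective_glue A).compactSpace (continuous_glue A)

/-! ### The twisted sum -/

/-- The space `X = {f ∈ C(L) : ∃ g ∈ C(𝔸(ι)), f(m) = m(g) for all m ∈ M₁(𝔸(ι))}`, with the norm
of `C(L)`. -/
def XSpace (A : ι × Fin 3 → Set ℕ) : NSubspace C(Ext A, ℝ) where
  carrier := {f | ∃ g : C(OnePoint ι, ℝ), ∀ m : MBall (OnePoint ι), f (.ball m) = m.1 g}
  zero_mem' := ⟨0, fun m => by simp⟩
  add_mem' := by
    rintro f f' ⟨g, hg⟩ ⟨g', hg'⟩
    exact ⟨g + g', fun m => by simp [hg, hg']⟩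
  smul_mem' := by
    rintro c f ⟨g, hg⟩
    exact ⟨c • g, fun m => by simp [hg]⟩

/-- The quotient map `X → C(𝔸(ι))`, sending `f` to the (unique) `g` with `f(m) = m(g)` for
`m ∈ M₁(𝔸(ι))`, that is, to `g(k) = f(δ_k)`; see `quotientMap_spec`. -/
def quotientMap (A : ι × Fin 3 → Set ℕ) : Op (XSpace A) C(OnePoint ι, ℝ) where
  toFun f := f.1.comp ((⟨Ext.ball, continuous_ball A⟩ : C(_, Ext A)).comp diracMap)
  map_add' _ _ := rfl
  map_smul' _ _ := rfl
  cont := (ContinuousMap.continuous_precomp _).comp continuous_subtype_val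

theorem quotientMap_spec (A : ι × Fin 3 → Set ℕ) (f : XSpace A) (m : MBall (OnePoint ι)) :
    f.1 (.ball m) = m.1 (quotientMap A f) := by
  obtain ⟨g, hg⟩ := f.2
  have : quotientMap A f = g := by
    ext k
    exact hg (diracMap k)
  rw [this, hg]

/-- The quotient map `X → c₀(ι)` obtained from an isomorphism `Φ` of `C(𝔸(ι))` and `c₀(ι)`. -/
def quotientMapC0 (A : ι × Fin 3 → Set ℕ) (Φ : Iso C(OnePoint ι, ℝ) C₀(ι, ℝ)) :
    Op (XSpace A) C₀(ι, ℝ) :=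
  (Φ : Op C(OnePoint ι, ℝ) C₀(ι, ℝ)).comp (quotientMap A)

/-- The function on `L` extending `a ∈ c₀` by zero on `M₁(𝔸(ι))`. -/
def extendZero (A : ι × Fin 3 → Set ℕ) (a : C₀(ℕ, ℝ)) : C(Ext A, ℝ) where
  toFun
    | .ball _ => 0
    | .nat n => a n
  continuous_toFun := by
    have ha : ∀ s ∈ 𝓝 (0 : ℝ), {n : ℕ | a n ∉ s}.Finite := by
      intro s hs
      have h := a.zero_at_infty' hs
      rw [cocompact_eq_cofinite] at h
      exact h
    refine continuous_coinduced_dom.2 (continuous_sum_dom.2 ⟨continuous_const, ?_⟩)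
    refine continuous_iff_continuousAt.2 fun y => ?_
    induction y using OnePoint.rec with
    | infty =>
      refine OnePoint.continuousAt_infty.2 fun s hs => ?_
      replace hs : s ∈ 𝓝 (0 : ℝ) := hs
      refine ⟨Psi.nat '' {n | a n ∉ s}, ⟨?_⟩, ((ha s hs).image _).isCompact, ?_⟩
      · intro j _
        refine (ha s hs).subset ?_
        rintro n ⟨_, hn⟩
        obtain ⟨m, hm, hmn⟩ := not_not.1 hn
        cases hmn
        exact hm
      · rintro (n | ⟨ξ, i⟩) hx
        · exact not_not.1 fun hn => hx ⟨n, hn, rfl⟩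
        · exact mem_of_mem_nhds hs
    | coe y =>
      refine OnePoint.continuousAt_coe.2 fun s hs => ?_
      rcases y with n | k
      · refine mem_nhds_iff.2 ⟨{Psi.nat n}, ?_, ?_, rfl⟩
        · rintro x rfl
          have hn : a n ∈ s := mem_of_mem_nhds hs
          exact hn
        · intro j hj
          cases hj
      · replace hs : s ∈ 𝓝 (0 : ℝ) := hs
        refine mem_nhds_iff.2 ⟨{Psi.lim k} ∪ Psi.nat '' {n | a n ∈ s}, ?_, ?_, Or.inl rfl⟩
        · rintro x (rfl | ⟨n, hn, rfl⟩)
          · exact (mem_of_mem_nhds hs : (0 : ℝ) ∈ s)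
          · exact hn
        · intro j _
          refine (ha s hs).subset ?_
          rintro n ⟨_, hn⟩
          exact fun h => hn (Or.inr ⟨n, h, rfl⟩)

theorem extendZero_ball (A : ι × Fin 3 → Set ℕ) (a : C₀(ℕ, ℝ)) (m : MBall (OnePoint ι)) :
    extendZero A a (.ball m) = 0 := rfl

theorem extendZero_nat (A : ι × Fin 3 → Set ℕ) (a : C₀(ℕ, ℝ)) (n : ℕ) :
    extendZero A a (.nat n) = a n := rfl

/-- The inclusion `c₀ → X`: extension by zero on `M₁(𝔸(ι))`. -/
def inclusion (A : ι × Fin 3 → Set ℕ) : Op C₀(ℕ, ℝ) (XSpace A) :=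
  LinearMap.mkContinuous
    { toFun := fun a => ⟨extendZero A a, 0, fun m => (map_zero m.1).symm⟩
      map_add' := fun a b => by
        ext x
        rcases x with m | n
        · exact (add_zero (0 : ℝ)).symm
        · rfl
      map_smul' := fun c a => by
        ext x
        rcases x with m | n
        · exact (mul_zero c).symm
        · rfl }
    1 fun a => by
      rw [one_mul]
      refine (ContinuousMap.norm_le _ (norm_nonneg a)).2 ?_
      rintro (m | n)
      · exact norm_zero.trans_le (norm_nonneg a)
      · exact a.toBCF.norm_coe_le_norm n

end Extension

/-! ### Short exact sequences and singularity -/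

/-- `0 → Y → X → Z → 0` is exact. -/
def IsShortExact {Y X Z : Type} [NormedAddCommGroup Y] [NormedSpace ℝ Y]
    [NormedAddCommGroup X] [NormedSpace ℝ X] [NormedAddCommGroup Z] [NormedSpace ℝ Z]
    (j : Op Y X) (p : Op X Z) : Prop :=
  Function.Injective j ∧ Function.Exact j p ∧ Function.Surjective p

/-- `T : X → Z` is `c₀(Γ)`-singular: for no subspace `Y` of `X` isomorphic to `c₀(Γ)` is the
restriction of `T` to `Y` an isomorphism of `Y` onto its image. -/
def IsC0Singular (Γ : Type) [TopologicalSpace Γ] {X Z : Type}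
    [NormedAddCommGroup X] [NormedSpace ℝ X] [NormedAddCommGroup Z] [NormedSpace ℝ Z]
    (T : Op X Z) : Prop :=
  ∀ Y : NSubspace X, Nonempty (Iso C₀(Γ, ℝ) Y) →
    ¬ ∃ e : Iso Y (Y.map (T : X →ₗ[ℝ] Z)), ∀ y : Y, (e y : Z) = T y

end TwistedSum

end

open TwistedSum

/-!
The twisted sum is easy to analyse once an admissible family is given; the set-theoretic hypothesis
`𝔭 = 𝔠` is only needed to construct such a family.

**The sequence.** `X` is closed in `C(L)`. A function in the kernel of the quotient map vanishes on
`M₁(𝔸(ι))`, so by compactness of `K_𝒜` it tends to zero on `ω` (`exact_inclusion_quotientMap`). For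
surjectivity, the values prescribed by `g ∈ C(𝔸(ι))` on the non-isolated points of `K_𝒜` are
continuous there, because `(g ξ - g ∞) / 2` tends to zero, and Tietze's theorem extends them to `ω`
(`quotientMap_surjective`).

**Singularity.** As the sets of the family are infinite, the points `σ_ξ` are in the closure of `ω`, so
an element of `X` that vanishes on `ω` comes from a constant `g`: in effect `X` embeds into `ℓ∞ ⊕ ℝ`.
A functional on `c₀(Γ)` is nonzero at only countably many unit vectors; if `Γ` is uncountable, then two
unit vectors are mapped to functions vanishing on `ω`, and a nontrivial combination of them is mapped
to `0`. So no operator `c₀(Γ) → X` is injective (`not_injective_c0`).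

**Admissible families.** They are built by a recursion along a well order of `ι` of type `𝔠`, treating
at each step one sequence `(μ_k)` in the unit ball of `ℓ₁` together with countably many bounded real
sequences, which control the convergence of `(lam_k)` (`exists_controlling_sequences`). All sets are
chosen almost disjoint from the columns of a fixed grid on `ω`, so that the complements of the fewer
than `𝔭` earlier sets belong to a common free filter. A pseudointersection argument gives an infinite
set `S`, almost disjoint from the earlier sets, along which everything relevant converges
(`exists_infinite_convergent`), in particular the masses `μ_k(B)` of the earlier sets `B` and
`μ_k({n}) → ν n`. A gliding hump in `S` (`exists_humps`) gives `x_0 < x_1 < ...` in `S` such that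
`μ_{x_m} - ν` lives, up to a null sequence, on disjoint intervals, the `m`-th of which contains `x_m`.
The three new sets consist of every third `x_m`. Later sets are required to be so sparse with respect to
these intervals (this is possible since `𝔭 ≤ 𝔟`, see `exists_dominating`) that the indices of the
intervals they meet form a set in a fixed proper ideal (`dyadicFilter`). Along ultrafilters extending
the dual filter on the three new sets, the measures `μ_k` therefore converge to measures whose values
agree on all clopen sets of `K_𝒜`, except for the atom `d δ` at the limit of the respective new set:
this is a fork (`exists_step`, `exists_fork`).
-/

open TwistedSum

namespace TwistedSum

/-! ### Consequences of `#I < 𝔭` -/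

theorem hasPseudointersection_of_card_lt {ℬ : Set (Set ℕ)} (hcard : #ℬ < pNumber)
    (h : StrongFIP ℬ) : HasPseudointersection ℬ := by
  by_contra hn
  exact notMem_of_lt_csInf hcard (OrderBot.bddBelow _) ⟨ℬ, rfl, h, hn⟩

/-- Fewer than `𝔭` members of a free filter on `ℕ` have an infinite pseudointersection. -/
theorem exists_pseudointersection {I : Type} (hI : #I < pNumber) (V : Filter ℕ) [V.NeBot]
    (hV : V ≤ cofinite) (s : I → Set ℕ) (hs : ∀ i, s i ∈ V) :
    ∃ S : Set ℕ, S.Infinite ∧ ∀ i, (S \ s i).Finite := by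
  obtain ⟨S, hS, h⟩ := hasPseudointersection_of_card_lt (ℬ := Set.range s)
    (mk_range_le.trans_lt hI) (fun F hF => by
      have hmem : (⋂ B ∈ F, B) ∈ V := by
        rw [Filter.biInter_finset_mem]
        intro B hB
        obtain ⟨i, rfl⟩ := hF hB
        exact hs i
      intro hfin
      refine V.empty_notMem ?_
      rw [← Set.inter_compl_self (⋂ B ∈ F, B)]
      exact inter_mem hmem (hV hfin.compl_mem_cofinite))
  exact ⟨S, hS, fun i => h _ ⟨i, rfl⟩⟩

theorem card_sum_lt {κ : Cardinal.{0}} (hκ : ℵ₀ < κ) {I J : Type} (hI : #I < κ) [Countable J] :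
    #(I ⊕ J) < κ := by
  rw [mk_sum, lift_id, lift_id]
  exact add_lt_of_lt hκ.le hI ((mk_le_aleph0 (α := J)).trans_lt hκ)

theorem card_prod_lt {κ : Cardinal.{0}} (hκ : ℵ₀ < κ) {I J : Type} (hI : #I < κ) [Countable J] :
    #(I × J) < κ := by
  rw [mk_prod, lift_id, lift_id]
  exact mul_lt_of_lt hκ.le hI ((mk_le_aleph0 (α := J)).trans_lt hκ)

theorem tendsto_atTop_inf_principal_of_subset {S T : Set ℕ} (h : (S \ T).Finite) :
    atTop ⊓ 𝓟 S ≤ 𝓟 T := by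
  rw [le_principal_iff, mem_inf_principal]
  rw [← Nat.cofinite_eq_atTop]
  refine mem_of_superset h.compl_mem_cofinite ?_
  intro n hn hS
  by_contra hT
  exact hn ⟨hS, hT⟩

/-- Given fewer than `𝔭` members of a free filter and fewer than `𝔭` bounded sequences, some infinite
set is almost contained in all the members, and all the sequences converge along it. -/
theorem exists_infinite_convergent {I J : Type} (h0 : ℵ₀ < pNumber) (hI : #I < pNumber)
    (hJ : #J < pNumber)
    (V : Filter ℕ) [V.NeBot] (hV : V ≤ cofinite) (s : I → Set ℕ) (hs : ∀ i, s i ∈ V)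
    (u : J → ℕ → ℝ) (hu : ∀ j k, |u j k| ≤ 1) :
    ∃ S : Set ℕ, S.Infinite ∧ (∀ i, (S \ s i).Finite) ∧
      ∀ j, ∃ l, Tendsto (u j) (atTop ⊓ 𝓟 S) (𝓝 l) := by
  -- Along an ultrafilter finer than `V` all the sequences converge.
  set W : Ultrafilter ℕ := Ultrafilter.of V
  have hWV : (W : Filter ℕ) ≤ V := Ultrafilter.of_le V
  have hlim : ∀ j, ∃ l, Tendsto (u j) W (𝓝 l) := by
    intro j
    have hK : IsCompact (Set.Icc (-1 : ℝ) 1) := isCompact_Icc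
    obtain ⟨l, _, hl⟩ := hK.ultrafilter_le_nhds' (W.map (u j))
      (Filter.mem_map.2 (Filter.univ_mem' fun k => abs_le.1 (hu j k)))
    exact ⟨l, hl⟩
  choose l hl using hlim
  obtain ⟨S, hS, h⟩ := exists_pseudointersection
    (I := I ⊕ (J × ℕ)) (by
      rw [mk_sum, lift_id, lift_id]
      exact add_lt_of_lt h0.le hI (card_prod_lt h0 hJ)) W (hWV.trans hV)
    (Sum.elim s fun p => {k | dist (u p.1 k) (l p.1) < 1 / ((p.2 : ℝ) + 1)}) (by
      rintro (i | ⟨j, m⟩)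
      · exact hWV (hs i)
      · exact (hl j).eventually (Metric.ball_mem_nhds _ Nat.one_div_pos_of_nat))
  refine ⟨S, hS, fun i => h (Sum.inl i), fun j => ⟨l j, ?_⟩⟩
  rw [Metric.tendsto_nhds]
  intro ε hε
  obtain ⟨m, hm⟩ := exists_nat_one_div_lt hε
  have := tendsto_atTop_inf_principal_of_subset (h (Sum.inr (j, m)))
  filter_upwards [le_principal_iff.1 this] with k hk
  exact lt_trans hk hm

/-- The free filter on `ℕ` of the sets that, for almost all `n`, contain almost all of the `n`-th
column of the grid `ℕ × ℕ ≃ ℕ`. -/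
def gridFilter : Filter ℕ := (atTop : Filter ℕ).bind fun n => map (Nat.pair n) atTop

theorem mem_gridFilter {s : Set ℕ} :
    s ∈ gridFilter ↔ ∀ᶠ n in atTop, ∀ᶠ m in atTop, Nat.pair n m ∈ s := by
  rw [gridFilter, mem_bind']
  rfl

instance : gridFilter.NeBot := by
  rw [neBot_iff, Ne, ← empty_mem_iff_bot, mem_gridFilter]
  simp only [Set.mem_empty_iff_false, eventually_const]
  exact not_false

theorem gridFilter_le_cofinite : gridFilter ≤ cofinite := by
  intro s hs
  rw [mem_gridFilter]
  rw [Nat.cofinite_eq_atTop, mem_atTop_sets] at hs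
  obtain ⟨a, ha⟩ := hs
  refine Eventually.of_forall fun n => eventually_atTop.2 ⟨a, fun m hm => ha _ ?_⟩
  exact hm.trans (Nat.right_le_pair n m)

/-- `𝔭 ≤ 𝔟`: fewer than `𝔭` functions `ℕ → ℕ` are dominated by a single one. -/
theorem exists_dominating {I : Type} (h0 : ℵ₀ < pNumber) (hI : #I < pNumber) (g : I → ℕ → ℕ) :
    ∃ h : ℕ → ℕ, ∀ i, ∀ᶠ n in atTop, g i n ≤ h n := by
  -- On the grid `ℕ × ℕ ≃ ℕ`, take a pseudointersection `S` of the regions above the graphs of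
  -- (monotone majorants of) the `g i` and of the half planes `{(k, m) : n ≤ k}`.
  set G : I → ℕ → ℕ := fun i n => ∑ k ∈ Finset.range (n + 1), g i k with hG
  have hGmono : ∀ i, Monotone (G i) := fun i a b hab =>
    Finset.sum_le_sum_of_subset (Finset.range_subset_range.2 (by omega))
  have hgG : ∀ i n, g i n ≤ G i n := fun i n =>
    Finset.single_le_sum (f := g i) (fun _ _ => Nat.zero_le _) (Finset.mem_range.2 (Nat.lt_succ_self n))
  obtain ⟨S, hS, h⟩ := exists_pseudointersection (I := I ⊕ ℕ) (card_sum_lt h0 hI) gridFilter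
    gridFilter_le_cofinite
    (Sum.elim (fun i => {x | G i x.unpair.1 ≤ x.unpair.2}) fun n => {x | n ≤ x.unpair.1}) (by
      rintro (i | n)
      · rw [mem_gridFilter]
        refine Eventually.of_forall fun n => ?_
        filter_upwards [eventually_ge_atTop (G i n)] with m hm
        simpa using hm
      · rw [mem_gridFilter]
        filter_upwards [eventually_ge_atTop n] with k hk
        refine Eventually.of_forall fun m => ?_
        simpa using hk)
  have hex : ∀ n, ∃ x ∈ S, n ≤ x.unpair.1 := fun n => by
    obtain ⟨x, hxS, hx⟩ := (hS.sdiff (h (Sum.inr n))).nonempty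
    exact ⟨x, hxS, by_contra fun hn => hx ⟨hxS, hn⟩⟩
  choose x hxS hx using hex
  refine ⟨fun n => (x n).unpair.2, fun i => ?_⟩
  have hfin := h (Sum.inl i)
  obtain ⟨b, hb⟩ := (hfin.image fun y => y.unpair.1).bddAbove
  filter_upwards [eventually_gt_atTop b] with n hn
  have hmem : G i (x n).unpair.1 ≤ (x n).unpair.2 := by
    by_contra hcon
    have : (x n).unpair.1 ≤ b := hb ⟨x n, ⟨hxS n, hcon⟩, rfl⟩
    exact absurd (hx n) (by omega)
  exact (hgG i n).trans ((hGmono i (hx n)).trans hmem)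

/-! ### Masses of sets under sequences of `ℓ₁` -/

/-- The mass `∑_{n ∈ D} f n` of the set `D` under the signed measure on `ℕ` with density `f`. -/
noncomputable def mass (f : ℕ → ℝ) (D : Set ℕ) : ℝ := ∑' n, D.indicator f n

theorem abs_mass_le {f : ℕ → ℝ} (hf : Summable f) (D : Set ℕ) : |mass f D| ≤ ∑' n, |f n| := by
  have h := norm_tsum_le_tsum_norm (f := D.indicator f) (hf.indicator D).norm
  refine h.trans ((hf.indicator D).norm.tsum_le_tsum (fun n => ?_) hf.norm)
  exact norm_indicator_le_norm_self f n

theorem mass_empty (f : ℕ → ℝ) : mass f ∅ = 0 := by simp [mass]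

theorem mass_singleton (f : ℕ → ℝ) (k : ℕ) : mass f {k} = f k := by
  rw [mass, tsum_eq_single k]
  · simp
  · intro n hn
    simp [hn]

theorem mass_finset (f : ℕ → ℝ) (F : Finset ℕ) : mass f F = ∑ n ∈ F, f n := by
  rw [mass, tsum_eq_sum (s := F)]
  · exact Finset.sum_congr rfl fun n hn => by simp [hn]
  · intro n hn
    simp [hn]

theorem exists_mass_Ici_le {f : ℕ → ℝ} (hf : Summable f) {ε : ℝ} (hε : 0 < ε) :
    ∃ b₀, ∀ b, b₀ ≤ b → mass (fun n => |f n|) (Set.Ici b) ≤ ε := by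
  have htail : ∀ b, mass (fun n => |f n|) (Set.Ici b) = ∑' k, |f (k + b)| := by
    intro b
    have hs : Summable ((Set.Ici b).indicator fun n => |f n|) := hf.abs.indicator _
    rw [mass, ← hs.sum_add_tsum_nat_add b, Finset.sum_eq_zero, zero_add]
    · exact tsum_congr fun k => by simp
    · intro n hn
      rw [Finset.mem_range] at hn
      simp [hn]
  have h := tendsto_sum_nat_add (fun n => |f n|)
  obtain ⟨b₀, h0⟩ := eventually_atTop.1 (h.eventually (ge_mem_nhds hε))
  exact ⟨b₀, fun b hb => (htail b).trans_le (h0 b hb)⟩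

/-- If `f` is close to `ν` on `[0, b)`, and `ν` is small on `[b, ∞)`, and `f` is small on `[b', ∞)`,
then `f - ν` is essentially the restriction of `f` to `[b, b')`. -/
theorem abs_mass_sub_le {f ν : ℕ → ℝ} (hf : Summable f) (hν : Summable ν) {b b' : ℕ} (hb : b ≤ b')
    {ε : ℝ} (h1 : ∑ n ∈ Finset.range b, |f n - ν n| ≤ ε)
    (h2 : mass (fun n => |ν n|) (Set.Ici b) ≤ ε) (h3 : mass (fun n => |f n|) (Set.Ici b') ≤ ε)
    (D : Set ℕ) : |mass f D - mass ν D - mass f (D ∩ Set.Ico b b')| ≤ 3 * ε := by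
  have s1 := hf.indicator D
  have s2 := hν.indicator D
  have s3 := hf.indicator (D ∩ Set.Ico b b')
  have e1 : mass f D - mass ν D - mass f (D ∩ Set.Ico b b') =
      ∑' n, (D.indicator f n - D.indicator ν n - (D ∩ Set.Ico b b').indicator f n) := by
    rw [mass, mass, mass, ← s1.tsum_sub s2, ← (s1.sub s2).tsum_sub s3]
  have t1 : Summable ((Finset.range b : Set ℕ).indicator fun n => |f n - ν n|) :=
    (hf.sub hν).abs.indicator _
  have t2 : Summable ((Set.Ici b).indicator fun n => |ν n|) := hν.abs.indicator _
  have t3 : Summable ((Set.Ici b').indicator fun n => |f n|) := hf.abs.indicator _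
  have e2 : ∑' n, ((Finset.range b : Set ℕ).indicator (fun n => |f n - ν n|) n +
      (Set.Ici b).indicator (fun n => |ν n|) n + (Set.Ici b').indicator (fun n => |f n|) n) ≤
      3 * ε := by
    rw [(t1.add t2).tsum_add t3, t1.tsum_add t2]
    have := (mass_finset (fun n => |f n - ν n|) (Finset.range b)).trans_le h1
    unfold mass at this h2 h3
    linarith
  rw [e1]
  refine (norm_tsum_le_tsum_norm ((s1.sub s2).sub s3).norm).trans (le_trans ?_ e2)
  refine ((s1.sub s2).sub s3).norm.tsum_le_tsum (fun n => ?_) ((t1.add t2).add t3)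
  rw [Real.norm_eq_abs]
  by_cases hD : n ∈ D
  · by_cases hn : n < b
    · have : ¬ b ≤ n := by omega
      have : ¬ b' ≤ n := by omega
      simp [Set.indicator, *]
    · by_cases hn' : n < b'
      · have : b ≤ n := by omega
        have : ¬ b' ≤ n := by omega
        simp [Set.indicator, *]
      · have : b ≤ n := by omega
        have : b' ≤ n := by omega
        simp only [Set.indicator, Finset.coe_range, Set.mem_Iio, Set.mem_inter_iff, Set.mem_Ico,
          Set.mem_Ici, *]
        simp only [if_true, and_false, if_false, sub_zero, zero_add]
        exact (abs_sub _ _).trans (add_comm _ _).le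
  · simp only [Set.indicator, hD, Set.mem_inter_iff, false_and, if_false, sub_zero, abs_zero]
    refine add_nonneg (add_nonneg ?_ ?_) ?_ <;> split_ifs <;> positivity

theorem summable_of_tendsto {l : Filter ℕ} [l.NeBot] {f : ℕ → ℕ → ℝ} (hf : ∀ k, Summable (f k))
    (hf1 : ∀ k, ∑' n, |f k n| ≤ 1) {ν : ℕ → ℝ} (hν : ∀ n, Tendsto (fun k => f k n) l (𝓝 (ν n))) :
    Summable ν := by
  rw [← summable_abs_iff]
  refine summable_of_sum_le (c := 1) (fun n => abs_nonneg _) fun F => ?_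
  refine le_of_tendsto (tendsto_finsetSum F fun n _ => (hν n).abs) (Eventually.of_forall fun k => ?_)
  exact ((hf k).abs.sum_le_tsum F fun n _ => abs_nonneg _).trans (hf1 k)

/-- A gliding hump: along a sequence `x` in `S`, the differences `f (x m) - ν` concentrate on
disjoint intervals `[b m, b (m + 1))`, each containing the corresponding `x m`, of prescribed
rate of growth. -/
theorem exists_humps {S : Set ℕ} (hS : S.Infinite) {f : ℕ → ℕ → ℝ} (hf : ∀ k, Summable (f k))
    {ν : ℕ → ℝ} (hν : Summable ν)
    (hlim : ∀ n, Tendsto (fun k => f k n) (atTop ⊓ 𝓟 S) (𝓝 (ν n))) (h : ℕ → ℕ) :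
    ∃ x b : ℕ → ℕ, (∀ m, x m ∈ S) ∧ (∀ m, b m ≤ x m) ∧ (∀ m, x m < b (m + 1)) ∧
      (∀ m, h (x m) < b (m + 1)) ∧ ∀ m D, |mass (f (x m)) D - mass ν D -
        mass (f (x m)) (D ∩ Set.Ico (b m) (b (m + 1)))| ≤ 3 * (1 / ((m : ℝ) + 1)) := by
  have : (atTop ⊓ 𝓟 S).NeBot := by
    rw [← frequently_mem_iff_neBot, Nat.frequently_atTop_iff_infinite]
    exact hS
  have hx : ∀ m b : ℕ, ∃ x ∈ S, b ≤ x ∧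
      ∑ n ∈ Finset.range b, |f x n - ν n| ≤ 1 / ((m : ℝ) + 1) := by
    intro m b
    have h1 : Tendsto (fun k => ∑ n ∈ Finset.range b, |f k n - ν n|) (atTop ⊓ 𝓟 S) (𝓝 0) := by
      have := tendsto_finsetSum (Finset.range b) fun n _ => ((hlim n).sub_const (ν n)).abs
      simpa using this
    have h2 := h1.eventually (ge_mem_nhds (Nat.one_div_pos_of_nat (n := m)))
    have h3 : ∀ᶠ k in atTop ⊓ 𝓟 S, b ≤ k := (eventually_ge_atTop b).filter_mono inf_le_left
    have h4 : ∀ᶠ k in atTop ⊓ 𝓟 S, k ∈ S := mem_inf_of_right (mem_principal_self S)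
    obtain ⟨k, hk⟩ := (h2.and (h3.and h4)).exists
    exact ⟨k, hk.2.2, hk.2.1, hk.1⟩
  have hb : ∀ m x : ℕ, ∃ b, x < b ∧ h x < b ∧
      mass (fun n => |f x n|) (Set.Ici b) ≤ 1 / ((m : ℝ) + 1) ∧
      mass (fun n => |ν n|) (Set.Ici b) ≤ 1 / (((m + 1 : ℕ) : ℝ) + 1) := by
    intro m x
    obtain ⟨b₁, h1⟩ := exists_mass_Ici_le (hf x) (Nat.one_div_pos_of_nat (n := m))
    obtain ⟨b₂, h2⟩ := exists_mass_Ici_le hν (Nat.one_div_pos_of_nat (n := m + 1))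
    exact ⟨x + h x + b₁ + b₂ + 1, by omega, by omega, h1 _ (by omega), h2 _ (by omega)⟩
  obtain ⟨b0, hb0⟩ := exists_mass_Ici_le hν (Nat.one_div_pos_of_nat (n := 0))
  choose X hXS hbX hX using hx
  choose Bd hxB hhB hB1 hB2 using hb
  let b : ℕ → ℕ := fun m => Nat.rec b0 (fun m b => Bd m (X m b)) m
  have hbs : ∀ m, b (m + 1) = Bd m (X m (b m)) := fun m => rfl
  have hbν : ∀ m, mass (fun n => |ν n|) (Set.Ici (b m)) ≤ 1 / ((m : ℝ) + 1) := by
    rintro (_ | m)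
    · exact hb0 _ le_rfl
    · exact hB2 _ _
  refine ⟨fun m => X m (b m), b, fun m => hXS _ _, fun m => hbX _ _, fun m => ?_, fun m => ?_,
    fun m D => ?_⟩
  · exact (hxB _ _).trans_eq (hbs m).symm
  · exact (hhB _ _).trans_eq (hbs m).symm
  · refine abs_mass_sub_le (hf _) hν ?_ (hX _ _) (hbν m) ?_ D
    · rw [hbs]
      exact (hbX _ _).trans (hxB _ _).le
    · rw [hbs]
      exact hB1 _ _

/-! ### The ideal of negligible sets of indices -/

/-- The filter dual to the ideal of the sets `E ⊆ ℕ` for which the numbers `|E ∩ [t, 2t)|` are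
bounded for large `t`. -/
noncomputable def dyadicFilter : Filter ℕ :=
  comk (fun E => ∃ r, ∀ᶠ t in atTop, (E ∩ Set.Ico t (2 * t)).ncard ≤ r)
    ⟨0, by simp⟩
    (fun E ⟨r, hr⟩ F hF => ⟨r, hr.mono fun t ht => (Set.ncard_le_ncard
      (Set.inter_subset_inter_left _ hF) ((Set.finite_Ico _ _).inter_of_right _)).trans ht⟩)
    (fun E ⟨r, hr⟩ F ⟨r', hr'⟩ => ⟨r + r', (hr.and hr').mono fun t ht => by
      rw [Set.union_inter_distrib_right]
      exact (Set.ncard_union_le _ _).trans (add_le_add ht.1 ht.2)⟩)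

theorem compl_mem_dyadicFilter {E : Set ℕ} : Eᶜ ∈ dyadicFilter ↔
    ∃ r, ∀ᶠ t in atTop, (E ∩ Set.Ico t (2 * t)).ncard ≤ r :=
  compl_mem_comk

instance : dyadicFilter.NeBot := by
  rw [neBot_iff, Ne, ← empty_mem_iff_bot, ← Set.compl_univ, compl_mem_dyadicFilter]
  rintro ⟨r, hr⟩
  obtain ⟨t, ht, hrt⟩ := (hr.and (eventually_gt_atTop r)).exists
  rw [Set.univ_inter, ← Finset.coe_Ico, Set.ncard_coe_finset, Nat.card_Ico] at ht
  omega

theorem dyadicFilter_le_atTop : dyadicFilter ≤ atTop := by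
  intro s hs
  rw [mem_atTop_sets] at hs
  obtain ⟨a, ha⟩ := hs
  rw [← compl_compl s, compl_mem_dyadicFilter]
  refine ⟨0, (eventually_ge_atTop a).mono fun t ht => ?_⟩
  have : sᶜ ∩ Set.Ico t (2 * t) = ∅ :=
    Set.eq_empty_of_forall_notMem fun n hn => hn.1 (ha n (ht.trans hn.2.1))
  rw [this, Set.ncard_empty]

theorem eventually_notMem_dyadicFilter {E : Set ℕ} {a : ℕ}
    (h : ∀ e ∈ E, ∀ e' ∈ E, a ≤ e → e < e' → 2 * e ≤ e') : ∀ᶠ n in dyadicFilter, n ∉ E := by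
  change Eᶜ ∈ dyadicFilter
  rw [compl_mem_dyadicFilter]
  refine ⟨1, (eventually_ge_atTop a).mono fun t ht => ?_⟩
  rw [Set.ncard_le_one_iff ((Set.finite_Ico _ _).inter_of_right _)]
  rintro e e' ⟨he, hte⟩ ⟨he', hte'⟩
  rw [Set.mem_Ico] at hte hte'
  rcases lt_trichotomy e e' with hlt | heq | hlt
  · have := h e he e' he' (ht.trans hte.1) hlt
    omega
  · exact heq
  · have := h e' he' e he (ht.trans hte'.1) hlt
    omega

/-! ### One step of the construction -/

/-- `B` meets every column of the grid `ℕ × ℕ ≃ ℕ` in a finite set. -/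
def Thin (B : Set ℕ) : Prop := ∀ n, {x ∈ B | x.unpair.1 = n}.Finite

/-- Almost every element `y` of `D` is followed in `D` by an element greater than `g y`. -/
def Sparse (g : ℕ → ℕ) (D : Set ℕ) : Prop :=
  ∀ᶠ y in atTop, y ∈ D → ∀ y' ∈ D, y < y' → g y < y'

theorem Thin.compl_mem_gridFilter {B : Set ℕ} (hB : Thin B) : Bᶜ ∈ gridFilter := by
  rw [mem_gridFilter]
  refine Eventually.of_forall fun n => ?_
  have hfin : {m | Nat.pair n m ∈ B}.Finite := by
    refine Set.Finite.of_finite_image ((hB n).subset ?_) (f := Nat.pair n) ?_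
    · rintro _ ⟨m, hm, rfl⟩
      exact ⟨hm, by simp⟩
    · intro m _ m' _ h
      exact (Nat.pair_eq_pair.1 h).2
  rw [← Nat.cofinite_eq_atTop]
  exact hfin.compl_mem_cofinite

/-- The data produced at one step: the three sets, a rate of growth which makes sets negligible
for this step, three ultrafilters, concentrated on the three sets, and the mass `d` of the atoms
of the fork. -/
structure Step where
  /-- The three sets. -/
  C : Fin 3 → Set ℕ
  /-- Sets that are sparse with respect to this function are negligible for the step. -/
  G : ℕ → ℕ
  /-- The ultrafilters along which the measures of the fork are obtained. -/
  U : Fin 3 → Ultrafilter ℕ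
  /-- The mass of the atoms of the fork. -/
  d : ℝ

/-- The limits of the masses of `D` along the three ultrafilters exist and are the same. -/
def Step.SameLimit (s : Step) (f : ℕ → ℕ → ℝ) (D : Set ℕ) : Prop :=
  ∃ L, ∀ i, Tendsto (fun k => mass (f k) D) (s.U i) (𝓝 L)

/-- The properties of a step that do not refer to the other steps: `f` is the sequence in `ℓ₁` that
is turned into a fork, and `a` consists of countably many sequences that are to converge along the
union of the three sets. -/
structure Step.IsGood (s : Step) (f : ℕ → ℕ → ℝ) (a : ℕ → ℕ → ℝ) : Prop where
  infinite : ∀ i, (s.C i).Infinite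
  disjoint : ∀ i j, i ≠ j → Disjoint (s.C i) (s.C j)
  thin : ∀ i, Thin (s.C i)
  mem : ∀ i, s.C i ∈ s.U i
  convergent : ∀ j, ∃ l, Tendsto (fun k => a k j) (atTop ⊓ 𝓟 (⋃ i, s.C i)) (𝓝 l)
  atom : ∀ i, Tendsto (fun k => f k k) (s.U i) (𝓝 s.d)
  same_univ : s.SameLimit f Set.univ
  same_finset : ∀ F : Finset ℕ, s.SameLimit f F
  same_sparse : ∀ D, Sparse s.G D → s.SameLimit f D
  limit_C : ∀ j, ∃ L, ∀ i,
    Tendsto (fun k => mass (f k) (s.C j)) (s.U i) (𝓝 (L + if i = j then s.d else 0))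

/-- The relation between an earlier step `e` and a later step `s`. -/
structure Step.Follows (s e : Step) (f : ℕ → ℕ → ℝ) : Prop where
  finite : ∀ i j, (s.C i ∩ e.C j).Finite
  sparse : ∀ i, Sparse e.G (s.C i)
  same : ∀ j, s.SameLimit f (e.C j)

theorem exists_step {f : ℕ → ℕ → ℝ} (hf : ∀ k, Summable (f k)) (hf1 : ∀ k, ∑' n, |f k n| ≤ 1)
    {a : ℕ → ℕ → ℝ} (ha : ∀ k j, |a k j| ≤ 1) (h0 : ℵ₀ < pNumber) {I : Type} (hI : #I < pNumber)
    (e : I → Step) (he : ∀ α i, Thin ((e α).C i)) :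
    ∃ s : Step, s.IsGood f a ∧ ∀ α, s.Follows (e α) f := by
  have hmass : ∀ k D, |mass (f k) D| ≤ 1 := fun k D => (abs_mass_le (hf k) D).trans (hf1 k)
  have hI3 : #(I × Fin 3) < pNumber := card_prod_lt h0 hI
  -- Consecutive humps will be further apart than `h` prescribes.
  obtain ⟨h, hh⟩ := exists_dominating h0 hI fun α => (e α).G
  obtain ⟨S, hS, hSV, hSu⟩ := exists_infinite_convergent (I := (I × Fin 3) ⊕ ℕ)
    (J := (I × Fin 3) ⊕ (ℕ ⊕ ℕ ⊕ Bool)) h0 (card_sum_lt h0 hI3) (card_sum_lt h0 hI3) gridFilter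
    gridFilter_le_cofinite
    (Sum.elim (fun p => ((e p.1).C p.2)ᶜ) fun n => {x | x.unpair.1 = n}ᶜ)
    (by
      rintro (⟨α, i⟩ | n)
      · exact (he α i).compl_mem_gridFilter
      · rw [Sum.elim_inr, mem_gridFilter]
        filter_upwards [eventually_gt_atTop n] with k hk
        refine Eventually.of_forall fun m => ?_
        simp only [Set.mem_compl_iff, Set.mem_ofPred_eq, Nat.unpair_pair]
        omega)
    (Sum.elim (fun p k => mass (f k) ((e p.1).C p.2)) (Sum.elim (fun n k => f k n)
      (Sum.elim (fun j k => a k j) fun t k => if t then f k k else mass (f k) Set.univ)))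
    (by
      have hfk : ∀ k n, |f k n| ≤ 1 := fun k n => by
        rw [← mass_singleton (f k) n]
        exact hmass _ _
      rintro (⟨α, i⟩ | n | j | t) k
      · exact hmass _ _
      · exact hfk k n
      · exact ha k j
      · cases t
        · exact hmass _ _
        · exact hfk k k)
  have hne : (atTop ⊓ 𝓟 S).NeBot := by
    rw [← frequently_mem_iff_neBot, Nat.frequently_atTop_iff_infinite]
    exact hS
  have lC : ∀ α i, ∃ l, Tendsto (fun k => mass (f k) ((e α).C i)) (atTop ⊓ 𝓟 S) (𝓝 l) :=
    fun α i => hSu (Sum.inl (α, i))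
  have lN : ∀ n, ∃ l, Tendsto (fun k => f k n) (atTop ⊓ 𝓟 S) (𝓝 l) :=
    fun n => hSu (Sum.inr (Sum.inl n))
  have la : ∀ j, ∃ l, Tendsto (fun k => a k j) (atTop ⊓ 𝓟 S) (𝓝 l) :=
    fun n => hSu (Sum.inr (Sum.inr (Sum.inl n)))
  obtain ⟨d, hd⟩ : ∃ l, Tendsto (fun k => f k k) (atTop ⊓ 𝓟 S) (𝓝 l) :=
    hSu (Sum.inr (Sum.inr (Sum.inr true)))
  obtain ⟨lu, hlu⟩ : ∃ l, Tendsto (fun k => mass (f k) Set.univ) (atTop ⊓ 𝓟 S) (𝓝 l) :=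
    hSu (Sum.inr (Sum.inr (Sum.inr false)))
  choose ν hν using lN
  have hνs : Summable ν := summable_of_tendsto hf hf1 hν
  obtain ⟨x, b, hxS, hbx, hxb, hhb, hump⟩ := exists_humps hS hf hνs hν h
  have hbmono : StrictMono b := strictMono_nat_of_lt_succ fun m => (hbx m).trans_lt (hxb m)
  have hxlt : ∀ {m m'}, m < m' → b (m + 1) ≤ x m' := fun {m m'} hm =>
    (hbmono.monotone (Nat.succ_le_of_lt hm)).trans (hbx m')
  have hxmono : StrictMono x := fun m m' hm => (hxb m).trans_le (hxlt hm)
  -- Every third hump is assigned to the same set.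
  let C : Fin 3 → Set ℕ := fun i => Set.range fun m => x (3 * m + i)
  let U : Fin 3 → Ultrafilter ℕ := fun i => (Ultrafilter.of dyadicFilter).map fun m => x (3 * m + i)
  have hCS : ∀ i, C i ⊆ S := by
    rintro i _ ⟨m, rfl⟩
    exact hxS _
  have hinj : ∀ i : Fin 3, Function.Injective fun m => x (3 * m + i) := fun i m m' hm => by
    have := hxmono.injective hm
    omega
  have hUmap : ∀ (i : Fin 3) {p : ℕ → Prop}, (∀ᶠ m in dyadicFilter, p (x (3 * m + i))) →
      ∀ᶠ k in U i, p k := fun i p hp => (Ultrafilter.of_le dyadicFilter) hp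
  have hUle : ∀ i, (U i : Filter ℕ) ≤ atTop ⊓ 𝓟 S := by
    intro i
    refine le_inf (fun s hs => ?_) (le_principal_iff.2 ?_)
    · refine hUmap i (p := (· ∈ s)) (dyadicFilter_le_atTop ?_)
      exact ((hxmono.comp fun m m' hm => by omega).tendsto_atTop :
        Tendsto (fun m => x (3 * m + i)) atTop atTop) hs
    · exact hUmap i (p := (· ∈ S)) (Eventually.of_forall fun m => hxS _)
  have hCU : ∀ i, C i ∈ U i := fun i =>
    hUmap i (p := (· ∈ C i)) (Eventually.of_forall fun m => ⟨m, rfl⟩)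
  -- Off the humps, the measures tend to `ν`.
  -- So only the mass `q` on the hump of `x_{3m+i}` itself has to be added.
  have key : ∀ (i : Fin 3) (D : Set ℕ) (q : ℕ → ℝ) (L : ℝ), (∀ᶠ m in dyadicFilter,
      mass (f (x (3 * m + i))) (D ∩ Set.Ico (b (3 * m + i)) (b (3 * m + i + 1))) =
        q (x (3 * m + i))) → Tendsto q (U i) (𝓝 L) →
      Tendsto (fun k => mass (f k) D) (U i) (𝓝 (mass ν D + L)) := by
    intro i D q L hq hL
    have h1 : Tendsto (fun k => mass (f k) D - mass ν D - q k) (U i) (𝓝 0) := by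
      have h2 : Tendsto (fun m : ℕ => 3 * (1 / (((3 * m + i : ℕ) : ℝ) + 1))) atTop (𝓝 0) := by
        have h3 : Tendsto (fun m : ℕ => 3 * m + (i : ℕ)) atTop atTop :=
          (show StrictMono fun m : ℕ => 3 * m + (i : ℕ) from
            fun m m' hm => by dsimp only; omega).tendsto_atTop
        simpa using (tendsto_one_div_add_atTop_nhds_zero_nat.comp h3).const_mul (3 : ℝ)
      have h4 : Tendsto (fun m => mass (f (x (3 * m + i))) D - mass ν D - q (x (3 * m + i)))
          dyadicFilter (𝓝 0) := by
        refine squeeze_zero_norm' ?_ (h2.mono_left dyadicFilter_le_atTop)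
        filter_upwards [hq] with m hm
        rw [← hm]
        exact hump _ D
      exact (h4.mono_left (Ultrafilter.of_le dyadicFilter) :)
    have h5 := (h1.add hL).add_const (mass ν D)
    rw [zero_add, add_comm L] at h5
    exact h5.congr fun k => by ring
  -- If `y < y'` in `D` lie in the humps with indices `3 * m + i < 3 * m' + i`, then `3 * m + i ≤ y`, and
  -- `b (2 * y + 3) < y'` forces `2 * m ≤ m'`.
  have hsparse : ∀ D, Sparse (fun y => b (2 * y + 3)) D → ∀ i : Fin 3, ∀ᶠ m in dyadicFilter,
      D ∩ Set.Ico (b (3 * m + i)) (b (3 * m + i + 1)) = ∅ := by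
    intro D hD i
    obtain ⟨y₀, hy⟩ := eventually_atTop.1 hD
    have := eventually_notMem_dyadicFilter (a := y₀)
      (E := {m | (D ∩ Set.Ico (b (3 * m + i)) (b (3 * m + i + 1))).Nonempty}) (by
        rintro m ⟨y, hyD, hym⟩ m' ⟨y', hyD', hym'⟩ hm hmm
        by_contra hlt
        have hmy : 3 * m + i ≤ y := (hbmono.le_apply).trans hym.1
        have hyy : y < y' := hym.2.trans_le ((hbmono.monotone (by omega)).trans hym'.1)
        have h1 : b (2 * y + 3) < y' := hy y (by omega) hyD y' hyD' hyy
        have h2 : b (3 * m' + i + 1) ≤ b (2 * y + 3) := hbmono.monotone (by omega)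
        exact absurd hym'.2 (by omega))
    filter_upwards [this] with m hm
    exact Set.not_nonempty_iff_eq_empty.1 hm
  have hdU : ∀ i, Tendsto (fun k => f k k) (U i) (𝓝 d) := fun i => hd.mono_left (hUle i)
  have hCfin : ∀ {T : Set ℕ}, (S \ Tᶜ).Finite → ∀ i, (C i ∩ T).Finite := fun {T} hT i =>
    hT.subset fun y hy => ⟨hCS i hy.1, fun h => h hy.2⟩
  refine ⟨⟨C, fun y => b (2 * y + 3), U, d⟩, ⟨fun i => Set.infinite_range_of_injective (hinj i),
    fun i j hij => ?_, fun i n => ?_, hCU, fun j => ?_, hdU, ⟨lu, fun i => hlu.mono_left (hUle i)⟩,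
    fun F => ⟨∑ n ∈ F, ν n, fun i => ?_⟩, fun D hD => ⟨mass ν D, fun i => ?_⟩,
    fun j => ⟨mass ν (C j), fun i => ?_⟩⟩,
    fun α => ⟨fun i j => hCfin (hSV (Sum.inl (α, j))) i, fun i => ?_, fun j => ?_⟩⟩
  · rw [Set.disjoint_left]
    rintro _ ⟨m, rfl⟩ ⟨m', hm'⟩
    have := hxmono.injective hm'
    exact hij (by omega)
  · exact hCfin (hSV (Sum.inr n)) i
  · obtain ⟨l, hl⟩ := la j
    refine ⟨l, hl.mono_left (inf_le_inf_left _ (principal_mono.2 ?_))⟩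
    exact Set.iUnion_subset hCS
  · simp only [mass_finset]
    exact tendsto_finsetSum F fun n _ => (hν n).mono_left (hUle i)
  · have := key i D (fun _ => 0) 0 ((hsparse D hD i).mono fun m hm => by rw [hm, mass_empty])
      tendsto_const_nhds
    rwa [add_zero] at this
  · by_cases hij : i = j
    · subst hij
      rw [if_pos rfl]
      refine key i (C i) (fun k => f k k) d (Eventually.of_forall fun m => ?_) (hdU i)
      have : C i ∩ Set.Ico (b (3 * m + i)) (b (3 * m + i + 1)) = {x (3 * m + i)} := by
        refine Set.Subset.antisymm ?_ ?_
        · rintro _ ⟨⟨m', rfl⟩, h1, h2⟩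
          rcases lt_trichotomy m m' with hlt | rfl | hlt
          · exact absurd h2 (hxlt (by omega)).not_gt
          · rfl
          · exact absurd h1 (not_le.2 ((hxb (3 * m' + i)).trans_le (hbmono.monotone (by omega))))
        · rintro _ rfl
          exact ⟨⟨m, rfl⟩, hbx _, hxb _⟩
      rw [this, mass_singleton]
    · rw [if_neg hij]
      refine key i (C j) (fun _ => 0) 0 (Eventually.of_forall fun m => ?_) tendsto_const_nhds
      have : C j ∩ Set.Ico (b (3 * m + i)) (b (3 * m + i + 1)) = ∅ := by
        refine Set.eq_empty_of_forall_notMem ?_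
        rintro _ ⟨⟨m', rfl⟩, h1, h2⟩
        have hne : 3 * m' + (j : ℕ) ≠ 3 * m + i := fun h => hij (by omega)
        rcases hne.lt_or_gt with hlt | hlt
        · exact absurd h1 (not_le.2 ((hxb (3 * m' + j)).trans_le (hbmono.monotone (by omega))))
        · exact absurd h2 (hxlt hlt).not_gt
      rw [this, mass_empty]
  · filter_upwards [hh α] with y hy
    rintro ⟨m, rfl⟩ _ ⟨m', rfl⟩ hlt
    exact hy.trans_lt ((hhb _).trans_le (hxlt (hxmono.lt_iff_lt.1 hlt)))
  · obtain ⟨l, hl⟩ := lC α j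
    exact ⟨l, fun i => hl.mono_left (hUle i)⟩

/-! ### Transfinite recursion -/

/-- Transfinite recursion: a unary and a binary requirement can be met at all places, provided that
this is possible at each single place. -/
theorem exists_of_wellFounded {ι T : Type*} [Nonempty T] {r : ι → ι → Prop} (hr : WellFounded r)
    (P : ι → T → Prop) (Q : ι → T → T → Prop)
    (hstep : ∀ ξ, ∀ F : {η // r η ξ} → T, (∀ η : {η // r η ξ}, P η (F η)) →
      ∃ t, P ξ t ∧ ∀ η : {η // r η ξ}, Q ξ t (F η)) :
    ∃ F : ι → T, ∀ ξ, P ξ (F ξ) ∧ ∀ η, r η ξ → Q ξ (F ξ) (F η) := by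
  let F : ι → T := hr.fix fun ξ prev =>
    Classical.epsilon fun t => P ξ t ∧ ∀ (η : ι) (h : r η ξ), Q ξ t (prev η h)
  have hF : ∀ ξ, F ξ = Classical.epsilon fun t => P ξ t ∧ ∀ η : ι, r η ξ → Q ξ t (F η) :=
    fun ξ => hr.fix_eq _ ξ
  refine ⟨F, fun ξ => ?_⟩
  induction ξ using hr.induction with
  | _ ξ ih =>
    obtain ⟨t, ht, htQ⟩ := hstep ξ (fun η => F η) fun η => (ih η η.2).1
    rw [hF ξ]
    exact Classical.epsilon_spec (p := fun t => P ξ t ∧ ∀ η : ι, r η ξ → Q ξ t (F η))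
      ⟨t, ht, fun η hη => htQ ⟨η, hη⟩⟩

/-! ### Functionals on `C(K)` and clopen sets -/

section Clopen

variable {K : Type} [TopologicalSpace K]

/-- The indicator function of a clopen set. -/
noncomputable def clopenFun (W : TopologicalSpace.Clopens K) : C(K, ℝ) :=
  ⟨(W : Set K).indicator 1, W.isClopen.continuous_indicator continuous_const⟩

theorem clopenFun_of_mem {W : TopologicalSpace.Clopens K} {x : K} (h : x ∈ W) :
    clopenFun W x = 1 := Set.indicator_of_mem (s := (W : Set K)) h 1

theorem clopenFun_of_notMem {W : TopologicalSpace.Clopens K} {x : K} (h : x ∉ W) :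
    clopenFun W x = 0 := Set.indicator_of_notMem (s := (W : Set K)) h 1

/-- A family of clopen sets that is closed under finite intersections and separates the points. -/
structure IsTestFamily (𝒯 : Set (TopologicalSpace.Clopens K)) : Prop where
  top_mem : ⊤ ∈ 𝒯
  inf_mem : ∀ V ∈ 𝒯, ∀ W ∈ 𝒯, V ⊓ W ∈ 𝒯
  separates : ∀ x y : K, x ≠ y → ∃ W ∈ 𝒯, ¬ (x ∈ W ↔ y ∈ W)

variable [CompactSpace K]

/-- A measure is determined by its values on a separating family of clopen sets that is closed under
finite intersections. -/
theorem IsTestFamily.ext {𝒯 : Set (TopologicalSpace.Clopens K)} (h𝒯 : IsTestFamily 𝒯)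
    {φ ψ : Meas K} (h : ∀ W ∈ 𝒯, φ (clopenFun W) = ψ (clopenFun W)) : φ = ψ := by
  let M : Submonoid C(K, ℝ) :=
    { carrier := clopenFun '' 𝒯
      one_mem' := ⟨⊤, h𝒯.top_mem, by
        ext x
        exact clopenFun_of_mem (W := ⊤) trivial⟩
      mul_mem' := by
        rintro _ _ ⟨V, hV, rfl⟩ ⟨W, hW, rfl⟩
        refine ⟨V ⊓ W, h𝒯.inf_mem V hV W hW, ?_⟩
        ext x
        exact congrFun Set.inter_indicator_one x }
  let B : Subalgebra ℝ C(K, ℝ) := Algebra.adjoin ℝ (clopenFun '' 𝒯)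
  have hsep : B.SeparatesPoints := by
    intro x y hxy
    obtain ⟨W, hW, hne⟩ := h𝒯.separates x y hxy
    refine ⟨clopenFun W, ⟨clopenFun W, Algebra.subset_adjoin ⟨W, hW, rfl⟩, rfl⟩, fun heq => hne ?_⟩
    by_cases hx : x ∈ W <;> by_cases hy : y ∈ W <;>
      simp [hx, hy, clopenFun_of_mem, clopenFun_of_notMem] at heq ⊢
  have hdense : Dense (B : Set C(K, ℝ)) := by
    have htop := ContinuousMap.subalgebra_topologicalClosure_eq_top_of_separatesPoints B hsep
    rw [dense_iff_closure_eq, ← Subalgebra.topologicalClosure_coe, htop]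
    rfl
  have hB : Set.EqOn φ ψ (B : Set C(K, ℝ)) := by
    intro f hf
    change f ∈ Subalgebra.toSubmodule B at hf
    rw [Algebra.adjoin_eq_span, show (clopenFun '' 𝒯) = (M : Set C(K, ℝ)) from rfl,
      Submonoid.closure_eq] at hf
    refine LinearMap.eqOn_span (f := (φ : C(K, ℝ) →ₗ[ℝ] ℝ)) (g := (ψ : C(K, ℝ) →ₗ[ℝ] ℝ)) ?_ hf
    rintro _ ⟨W, hW, rfl⟩
    exact h W hW
  exact DFunLike.coe_injective (φ.continuous.ext_on hdense ψ.continuous hB)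

theorem continuous_ball_eval {E : Type} [NormedAddCommGroup E] [NormedSpace ℝ E] (x : E) :
    Continuous fun m : DualBall E => m.1 x :=
  (WeakDual.eval_continuous x).comp continuous_subtype_val

/-- In `M₁(K)`, convergence on a test family suffices for weak* convergence. -/
theorem IsTestFamily.exists_tendsto {𝒯 : Set (TopologicalSpace.Clopens K)} (h𝒯 : IsTestFamily 𝒯)
    {α : Type} {F : Filter α} [F.NeBot] {lam : α → MBall K}
    (h : ∀ W ∈ 𝒯, ∃ L, Tendsto (fun k => (lam k).1 (clopenFun W)) F (𝓝 L)) :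
    ∃ l, Tendsto lam F (𝓝 l) := by
  have huniq : ∀ l, ClusterPt l (map lam F) → ∀ W ∈ 𝒯, ∀ L,
      Tendsto (fun k => (lam k).1 (clopenFun W)) F (𝓝 L) → l.1 (clopenFun W) = L := by
    intro l hl W _ L hL
    have h1 : MapClusterPt (l.1 (clopenFun W)) F fun k => (lam k).1 (clopenFun W) :=
      MapClusterPt.continuousAt_comp (f := fun m : MBall K => m.1 (clopenFun W))
        (continuous_ball_eval _).continuousAt hl
    have h2 : ClusterPt (l.1 (clopenFun W)) (𝓝 L) := ClusterPt.mono h1 hL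
    exact eq_of_nhds_neBot h2
  obtain ⟨l, hl⟩ := exists_clusterPt_of_compactSpace (map lam F)
  refine ⟨l, le_nhds_of_unique_clusterPt fun l' hl' => ?_⟩
  refine Subtype.ext (h𝒯.ext fun W hW => ?_)
  obtain ⟨L, hL⟩ := h W hW
  exact (huniq l' hl' W hW L hL).trans (huniq l hl W hW L hL).symm

end Clopen

/-! ### Functionals have countable supports -/

/-- A functional vanishes at all but countably many members of a family that behaves like the unit
vectors of a space `c₀(Γ)`. -/
theorem countable_support {E Γ : Type} [NormedAddCommGroup E] [NormedSpace ℝ E] (x : Γ → E)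
    (hx : ∀ (F : Finset Γ) (s : Γ → ℝ), (∀ γ, |s γ| ≤ 1) → ‖∑ γ ∈ F, s γ • x γ‖ ≤ 1)
    (φ : E →L[ℝ] ℝ) : {γ | φ (x γ) ≠ 0}.Countable := by
  have hsum : ∀ F : Finset Γ, ∑ γ ∈ F, |φ (x γ)| ≤ ‖φ‖ := by
    intro F
    have h1 : φ (∑ γ ∈ F, (SignType.sign (φ (x γ)) : ℝ) • x γ) = ∑ γ ∈ F, |φ (x γ)| := by
      rw [map_sum]
      refine Finset.sum_congr rfl fun γ _ => ?_
      rw [map_smul, smul_eq_mul, sign_mul_self]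
    rw [← h1]
    refine (le_abs_self _).trans ((φ.le_opNorm _).trans ?_)
    refine mul_le_of_le_one_right (norm_nonneg _) (hx F _ fun γ => ?_)
    rcases lt_trichotomy (φ (x γ)) 0 with h | h | h
    · simp [sign_neg h]
    · simp [h]
    · simp [sign_pos h]
  have hs : Summable fun γ => |φ (x γ)| := summable_of_sum_le (fun γ => abs_nonneg _) hsum
  refine hs.countable_support.mono fun γ hγ => ?_
  exact abs_ne_zero.2 hγ

/-! ### The topology of the Alexandroff-Urysohn compactum -/

section Psi

variable {J : Type} {A : J → Set ℕ}

theorem Psi.isOpen_iff {U : Set (Psi A)} :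
    IsOpen U ↔ ∀ j, Psi.lim j ∈ U → {n ∈ A j | Psi.nat n ∉ U}.Finite := Iff.rfl

theorem Psi.tendsto_nat (j : J) :
    Tendsto (fun n : A j => (Psi.nat n : Psi A)) cofinite (𝓝 (Psi.lim j)) := by
  rw [tendsto_nhds]
  intro U hU hj
  have h := (Psi.isOpen_iff.1 hU j hj).preimage (Subtype.val_injective (p := (· ∈ A j))).injOn
  refine mem_cofinite.2 (h.subset fun n hn => ⟨n.2, hn⟩)

/-- The basic neighbourhood `{p_j} ∪ A j` of `p_j`. -/
def Psi.basic (A : J → Set ℕ) (j : J) : Set (Psi A) :=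
  insert (Psi.lim j) (Set.range fun n : A j => (Psi.nat n : Psi A))

@[simp] theorem Psi.nat_mem_basic {j : J} {n : ℕ} : Psi.nat n ∈ Psi.basic A j ↔ n ∈ A j := by
  simp [Psi.basic]

@[simp] theorem Psi.lim_mem_basic {j k : J} : Psi.lim k ∈ Psi.basic A j ↔ k = j := by
  simp [Psi.basic]

theorem Psi.isCompact_basic (j : J) : IsCompact (Psi.basic A j) :=
  (Psi.tendsto_nat j).isCompact_insert_range_of_cofinite

theorem Psi.isClopen_basic (hA : ∀ j k, j ≠ k → (A j ∩ A k).Finite) (j : J) :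
    IsClopen (Psi.basic A j) := by
  refine ⟨⟨?_⟩, ?_⟩
  · rw [Psi.isOpen_iff]
    intro k hk
    have hkj : k ≠ j := fun h => hk (Psi.lim_mem_basic.2 h)
    refine (hA k j hkj).subset fun n hn => ⟨hn.1, ?_⟩
    exact Psi.nat_mem_basic.1 (not_not.1 hn.2)
  · rw [Psi.isOpen_iff]
    intro k hk
    obtain rfl := Psi.lim_mem_basic.1 hk
    convert Set.finite_empty (α := ℕ)
    refine Set.eq_empty_of_forall_notMem fun n hn => hn.2 ?_
    exact Psi.nat_mem_basic.2 hn.1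

theorem Psi.isClopen_image_nat {F : Set ℕ} (hF : F.Finite) :
    IsClopen ((Psi.nat : ℕ → Psi A) '' F) := by
  refine ⟨⟨?_⟩, ?_⟩
  · rw [Psi.isOpen_iff]
    intro k _
    refine hF.subset fun n hn => ?_
    obtain ⟨m, hm, hmn⟩ := not_not.1 hn.2
    cases hmn
    exact hm
  · rw [Psi.isOpen_iff]
    rintro k ⟨n, -, hn⟩
    cases hn

theorem Psi.t2Space (hA : ∀ j k, j ≠ k → (A j ∩ A k).Finite) : T2Space (Psi A) := by
  have hsep : ∀ {x y : Psi A} (U : Set (Psi A)), IsClopen U → x ∈ U → y ∉ U →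
      ∃ u v, IsOpen u ∧ IsOpen v ∧ x ∈ u ∧ y ∈ v ∧ Disjoint u v :=
    fun U hU hx hy => ⟨U, Uᶜ, hU.2, hU.1.isOpen_compl, hx, hy, disjoint_compl_right⟩
  have hnat : ∀ (n : ℕ) (y : Psi A), Psi.nat n ≠ y →
      ∃ u v, IsOpen u ∧ IsOpen v ∧ Psi.nat n ∈ u ∧ y ∈ v ∧ Disjoint u v := fun n y hy =>
    hsep _ (Psi.isClopen_image_nat (Set.finite_singleton n)) ⟨n, rfl, rfl⟩ (by
      rintro ⟨m, rfl, h⟩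
      exact hy h)
  refine ⟨fun x y hxy => ?_⟩
  rcases x with n | j
  · exact hnat n y hxy
  rcases y with n | k
  · obtain ⟨u, v, hu, hv, hx, hy, huv⟩ := hnat n _ hxy.symm
    exact ⟨v, u, hv, hu, hy, hx, huv.symm⟩
  · refine hsep _ (Psi.isClopen_basic hA j) (Psi.lim_mem_basic.2 rfl) fun h => hxy ?_
    rw [Psi.lim_mem_basic.1 h]

theorem Psi.weaklyLocallyCompactSpace (hA : ∀ j k, j ≠ k → (A j ∩ A k).Finite) :
    WeaklyLocallyCompactSpace (Psi A) := by
  refine ⟨fun x => ?_⟩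
  rcases x with n | j
  · exact ⟨_, (Set.finite_singleton n).image _ |>.isCompact,
      (Psi.isClopen_image_nat (Set.finite_singleton n)).2.mem_nhds ⟨n, rfl, rfl⟩⟩
  · exact ⟨_, Psi.isCompact_basic j, (Psi.isClopen_basic hA j).2.mem_nhds (Psi.lim_mem_basic.2 rfl)⟩

theorem AUSpace.normalSpace (hA : ∀ j k, j ≠ k → (A j ∩ A k).Finite) :
    NormalSpace (AUSpace A) := by
  have := Psi.t2Space hA
  have := Psi.weaklyLocallyCompactSpace hA
  infer_instance

theorem limPt_injective : Function.Injective (limPt A) := fun j k h => by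
  have := OnePoint.coe_injective h
  cases this
  rfl

theorem natPt_ne_limPt {n : ℕ} {j : J} : natPt A n ≠ limPt A j := fun h => by
  have := OnePoint.coe_injective h
  cases this

theorem tendsto_natPt (j : J) :
    Tendsto (fun n : A j => natPt A n) cofinite (𝓝 (limPt A j)) :=
  (OnePoint.continuous_coe.tendsto _).comp (Psi.tendsto_nat j)

end Psi

/-! ### Clopen sets in one-point compactifications -/

/-- Compact clopen sets remain clopen in the one-point compactification. -/
def compactClopen {X : Type} [TopologicalSpace X] (U : Set X) (hU : IsClopen U)
    (hc : IsCompact U) : TopologicalSpace.Clopens (OnePoint X) where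
  carrier := (↑) '' U
  isClopen' := ⟨⟨OnePoint.isOpen_compl_image_coe.2 ⟨hU.1, hc⟩⟩, OnePoint.isOpen_image_coe.2 hU.2⟩

theorem mem_compactClopen {X : Type} [TopologicalSpace X] {U : Set X} {hU : IsClopen U}
    {hc : IsCompact U} {x : OnePoint X} :
    x ∈ compactClopen U hU hc ↔ x ∈ ((↑) '' U : Set (OnePoint X)) := Iff.rfl

section AUSpace

variable {J : Type} {A : J → Set ℕ}

/-- The clopen set `{p_j} ∪ A j` of `K_𝒜`. -/
def limClopen (hA : ∀ j k, j ≠ k → (A j ∩ A k).Finite) (j : J) :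
    TopologicalSpace.Clopens (AUSpace A) :=
  compactClopen (Psi.basic A j) (Psi.isClopen_basic hA j) (Psi.isCompact_basic j)

/-- A finite set of isolated points of `K_𝒜`. -/
def finClopen (A : J → Set ℕ) (F : Finset ℕ) : TopologicalSpace.Clopens (AUSpace A) :=
  compactClopen (Psi.nat '' (F : Set ℕ)) (Psi.isClopen_image_nat F.finite_toSet)
    (F.finite_toSet.image _).isCompact

variable {hA : ∀ j k, j ≠ k → (A j ∩ A k).Finite}

@[simp] theorem natPt_mem_limClopen {j : J} {n : ℕ} : natPt A n ∈ limClopen hA j ↔ n ∈ A j := by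
  simp [limClopen, mem_compactClopen, natPt]

@[simp] theorem limPt_mem_limClopen {j k : J} : limPt A k ∈ limClopen hA j ↔ k = j := by
  simp [limClopen, mem_compactClopen, limPt]

@[simp] theorem infty_notMem_limClopen {j : J} : OnePoint.infty ∉ limClopen hA j := by
  simp [limClopen, mem_compactClopen]

@[simp] theorem natPt_mem_finClopen {F : Finset ℕ} {n : ℕ} : natPt A n ∈ finClopen A F ↔ n ∈ F := by
  simp [finClopen, mem_compactClopen, natPt]

@[simp] theorem limPt_notMem_finClopen {F : Finset ℕ} {j : J} : limPt A j ∉ finClopen A F := by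
  simp [finClopen, mem_compactClopen, limPt]

@[simp] theorem infty_notMem_finClopen {F : Finset ℕ} : OnePoint.infty ∉ finClopen A F := by
  simp [finClopen, mem_compactClopen]

@[elab_as_elim] theorem AUSpace.cases {p : AUSpace A → Prop} (infty : p OnePoint.infty)
    (nat : ∀ n, p (natPt A n)) (lim : ∀ j, p (limPt A j)) (x : AUSpace A) : p x := by
  induction x using OnePoint.rec with
  | infty => exact infty
  | coe x =>
    rcases x with n | j
    · exact nat n
    · exact lim j

theorem AUSpace.isTestFamily (hA : ∀ j k, j ≠ k → (A j ∩ A k).Finite) :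
    IsTestFamily ({⊤} ∪ Set.range (limClopen hA) ∪ Set.range (finClopen A)) := by
  classical
  have hfin : ∀ (V : TopologicalSpace.Clopens (AUSpace A)) (F : Finset ℕ),
      V ⊓ finClopen A F ∈ Set.range (finClopen A) := by
    intro V F
    refine ⟨F.filter fun n => natPt A n ∈ V, ?_⟩
    ext x
    change x ∈ finClopen A _ ↔ x ∈ V ∧ x ∈ finClopen A F
    induction x using AUSpace.cases <;> simp [and_comm]
  refine ⟨Or.inl (Or.inl rfl), ?_, ?_⟩
  · rintro V ((rfl | ⟨j, rfl⟩) | ⟨F, rfl⟩) W hW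
    · rwa [top_inf_eq]
    · rcases hW with (rfl | ⟨k, rfl⟩) | ⟨F, rfl⟩
      · rw [inf_top_eq]
        exact Or.inl (Or.inr ⟨j, rfl⟩)
      · by_cases hjk : j = k
        · subst hjk
          rw [inf_idem]
          exact Or.inl (Or.inr ⟨j, rfl⟩)
        · refine Or.inr ⟨(hA j k hjk).toFinset, ?_⟩
          ext x
          change x ∈ finClopen A _ ↔ x ∈ limClopen hA j ∧ x ∈ limClopen hA k
          induction x using AUSpace.cases with
          | infty => simp
          | nat n => simp
          | lim l =>
            simp only [limPt_notMem_finClopen, limPt_mem_limClopen, false_iff]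
            rintro ⟨rfl, rfl⟩
            exact hjk rfl
      · exact Or.inr (hfin _ F)
    · rw [inf_comm]
      exact Or.inr (hfin _ F)
  · have hnat : ∀ n (y : AUSpace A), natPt A n ≠ y → ¬ (natPt A n ∈ finClopen A {n} ↔
        y ∈ finClopen A {n}) := by
      intro n y hy
      induction y using AUSpace.cases with
      | infty => simp
      | nat m => simpa using fun h : m = n => hy (h ▸ rfl)
      | lim l => simp
    have hlim : ∀ j (y : AUSpace A), limPt A j ≠ y → (∀ n, natPt A n ≠ y) →
        ¬ (limPt A j ∈ limClopen hA j ↔ y ∈ limClopen hA j) := by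
      intro j y hy hn
      induction y using AUSpace.cases with
      | infty => simp
      | nat m => exact absurd rfl (hn m)
      | lim l => simpa using fun h : l = j => hy (h ▸ rfl)
    intro x y hxy
    by_cases hx : ∃ n, natPt A n = x
    · obtain ⟨n, rfl⟩ := hx
      exact ⟨_, Or.inr ⟨{n}, rfl⟩, hnat n y hxy⟩
    by_cases hy : ∃ n, natPt A n = y
    · obtain ⟨n, rfl⟩ := hy
      exact ⟨_, Or.inr ⟨{n}, rfl⟩, fun h => hnat n x hxy.symm h.symm⟩
    rw [not_exists] at hx hy
    induction x using AUSpace.cases with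
    | nat n => exact absurd rfl (hx n)
    | lim j => exact ⟨_, Or.inl (Or.inr ⟨j, rfl⟩), hlim j y hxy hy⟩
    | infty =>
      induction y using AUSpace.cases with
      | infty => exact absurd rfl hxy
      | nat n => exact absurd rfl (hy n)
      | lim j => exact ⟨_, Or.inl (Or.inr ⟨j, rfl⟩), fun h => hlim j _ hxy.symm hx h.symm⟩

end AUSpace

section Discrete

variable {ι : Type} [TopologicalSpace ι] [DiscreteTopology ι]

/-- The isolated point `ξ` of `𝔸(ι)`, as a clopen set. -/
def pointClopen (ξ : ι) : TopologicalSpace.Clopens (OnePoint ι) :=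
  compactClopen {ξ} (isClopen_discrete _) isCompact_singleton

@[simp] theorem mem_pointClopen {ξ : ι} {x : OnePoint ι} : x ∈ pointClopen ξ ↔ x = ξ := by
  simp [pointClopen, mem_compactClopen]

theorem isTestFamily_discrete :
    IsTestFamily ({⊤, ⊥} ∪ Set.range (pointClopen : ι → TopologicalSpace.Clopens (OnePoint ι))) := by
  refine ⟨Or.inl (Or.inl rfl), ?_, ?_⟩
  · rintro V ((rfl | rfl) | ⟨ξ, rfl⟩) W hW
    · rwa [top_inf_eq]
    · rw [bot_inf_eq]
      exact Or.inl (Or.inr rfl)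
    · by_cases h : (ξ : OnePoint ι) ∈ W
      · refine Or.inr ⟨ξ, (inf_eq_left.2 fun x hx => ?_).symm⟩
        rwa [mem_pointClopen.1 hx]
      · refine Or.inl (Or.inr (eq_bot_iff.2 fun x hx => ?_))
        rw [mem_pointClopen.1 hx.1] at hx
        exact absurd hx.2 h
  · have hpt : ∀ (ξ : ι) (y : OnePoint ι), (ξ : OnePoint ι) ≠ y →
        ¬ ((ξ : OnePoint ι) ∈ pointClopen ξ ↔ y ∈ pointClopen ξ) := by
      intro ξ y hy
      simpa using hy.symm
    intro x y hxy
    induction x using OnePoint.rec with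
    | coe ξ => exact ⟨_, Or.inr ⟨ξ, rfl⟩, hpt ξ y hxy⟩
    | infty =>
      induction y using OnePoint.rec with
      | infty => exact absurd rfl hxy
      | coe ξ => exact ⟨_, Or.inr ⟨ξ, rfl⟩, fun h => hpt ξ _ hxy.symm h.symm⟩

end Discrete

/-! ### Measures given by `ℓ₁` -/

theorem summable_abs_lp (m : lp (fun _ : ℕ => ℝ) 1) : Summable fun n => |m n| := by
  have h := lp.memℓp m
  rw [memℓp_gen_iff (by simp)] at h
  simpa using h

theorem tsum_abs_lp (m : lp (fun _ : ℕ => ℝ) 1) : ∑' n, |m n| = ‖m‖ := by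
  have h := lp.norm_eq_tsum_rpow (p := 1) (by simp) m
  simpa using h.symm

section EllOne

variable {J : Type} {A : J → Set ℕ}

theorem ellOneMeasure_apply (m : lp (fun _ : ℕ => ℝ) 1) (f : C(AUSpace A, ℝ)) :
    ellOneMeasure A m f = ∑' n, m n * f (natPt A n) := by
  have hs : Summable fun n => m n • dirac (natPt A n) := by
    refine Summable.of_norm_bounded (summable_abs_lp m) fun n => ?_
    rw [norm_smul]
    exact mul_le_of_le_one_right (norm_nonneg _) (norm_dirac_le _)
  exact (ContinuousLinearMap.apply ℝ ℝ f).map_tsum hs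

theorem norm_ellOneMeasure_le (m : lp (fun _ : ℕ => ℝ) 1) : ‖ellOneMeasure A m‖ ≤ ‖m‖ := by
  refine ContinuousLinearMap.opNorm_le_bound _ (norm_nonneg m) fun f => ?_
  rw [ellOneMeasure_apply, ← tsum_abs_lp, ← tsum_mul_right]
  refine tsum_of_norm_bounded ((summable_abs_lp m).mul_right _).hasSum fun n => ?_
  rw [norm_mul]
  exact mul_le_mul_of_nonneg_left (f.norm_coe_le_norm _) (norm_nonneg _)

theorem ellOneMeasure_clopenFun (m : lp (fun _ : ℕ => ℝ) 1) (W : TopologicalSpace.Clopens (AUSpace A)) :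
    ellOneMeasure A m (clopenFun W) = mass m {n | natPt A n ∈ W} := by
  rw [ellOneMeasure_apply, mass]
  refine tsum_congr fun n => ?_
  by_cases h : natPt A n ∈ W
  · rw [clopenFun_of_mem h, mul_one, Set.indicator_of_mem (by exact h)]
  · rw [clopenFun_of_notMem h, mul_zero, Set.indicator_of_notMem (by exact h)]

end EllOne

/-! ### Admissible families exist -/

/-- If `A` is obtained from a good step, namely `A (ξ, i) = s.C i`, and if the limits of the masses of
the other sets of the family along the three ultrafilters of the step are the same, then there is a
fork at the points given by `A (ξ, 0), A (ξ, 1), A (ξ, 2)`. -/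
theorem exists_fork {ι : Type} {A : ι × Fin 3 → Set ℕ}
    (hA : ∀ j k, j ≠ k → (A j ∩ A k).Finite) {μ : ℕ → lp (fun _ : ℕ => ℝ) 1}
    (hμ : ∀ k, ‖μ k‖ ≤ 1) {c : ℝ} (hc0 : 0 < c) (hc : ∀ k, c ≤ |μ k k|) {a : ℕ → ℕ → ℝ} {s : Step}
    (hs : s.IsGood (fun k => μ k) a) (ξ : ι) (hξ : ∀ i, A (ξ, i) = s.C i)
    (hsame : ∀ η i, η ≠ ξ → s.SameLimit (fun k => μ k) (A (η, i))) :
    ∃ φ : Fin 3 → Meas (AUSpace A), IsForkAt c (c / 2) (fun i => limPt A (ξ, i)) φ ∧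
      ∀ i, toWStar (φ i) ∈
        closure ((fun k => toWStar (ellOneMeasure A (μ k))) '' ⋃ i, s.C i) := by
  let g : ℕ → MBall (AUSpace A) := fun k =>
    ballPoint (ellOneMeasure A (μ k)) ((norm_ellOneMeasure_le _).trans (hμ k))
  have hlim : ∀ i, ∃ l, Tendsto g (s.U i) (𝓝 l) := fun i =>
    ⟨_, ((s.U i).map g).le_nhds_lim⟩
  choose l hl using hlim
  let φ : Fin 3 → Meas (AUSpace A) := fun i => WeakDual.toStrongDual (l i).1
  have hφ : ∀ i W L, Tendsto (fun k => mass (μ k) {n | natPt A n ∈ W}) (s.U i) (𝓝 L) →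
      φ i (clopenFun W) = L := by
    intro i W L hL
    have h1 := ((continuous_ball_eval (clopenFun W)).tendsto (l i)).comp (hl i)
    refine tendsto_nhds_unique h1 (hL.congr fun k => ?_)
    exact (ellOneMeasure_clopenFun (μ k) W).symm
  -- The three limits differ from the atoms by the same measure.
  have heq : ∀ i j, φ i - s.d • dirac (limPt A (ξ, i)) = φ j - s.d • dirac (limPt A (ξ, j)) := by
    intro i j
    refine (AUSpace.isTestFamily hA).ext fun W hW => ?_
    have hsub : ∀ i, (φ i - s.d • dirac (limPt A (ξ, i))) (clopenFun W) =
      φ i (clopenFun W) - s.d * clopenFun W (limPt A (ξ, i)) := fun i => rfl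
    rw [hsub, hsub]
    have hsame' : s.SameLimit (fun k => μ k) {n | natPt A n ∈ W} →
        (∀ i j, clopenFun W (limPt A (ξ, i)) = clopenFun W (limPt A (ξ, j))) →
        φ i (clopenFun W) - s.d * clopenFun W (limPt A (ξ, i)) =
          φ j (clopenFun W) - s.d * clopenFun W (limPt A (ξ, j)) := by
      rintro ⟨L, hL⟩ h
      rw [hφ i W L (hL i), hφ j W L (hL j), h i j]
    rcases hW with (rfl | ⟨⟨η, m⟩, rfl⟩) | ⟨F, rfl⟩
    · refine hsame' hs.same_univ fun i j => ?_
      rw [clopenFun_of_mem (by trivial), clopenFun_of_mem (by trivial)]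
    · by_cases hη : η = ξ
      · subst hη
        obtain ⟨L, hL⟩ := hs.limit_C m
        have hval : ∀ i, φ i (clopenFun (limClopen hA (η, m))) -
            s.d * clopenFun (limClopen hA (η, m)) (limPt A (η, i)) = L := by
          intro i
          rw [hφ i _ _ (by simpa [hξ] using hL i)]
          by_cases him : i = m
          · subst him
            rw [clopenFun_of_mem (by simp), if_pos rfl]
            ring
          · rw [clopenFun_of_notMem (by simpa using him), if_neg him]
            ring
        rw [hval, hval]
      · refine hsame' (by simpa using hsame η m hη) fun i j => ?_
        rw [clopenFun_of_notMem (by simp [Ne.symm hη]), clopenFun_of_notMem (by simp [Ne.symm hη])]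
    · refine hsame' (by simpa using hs.same_finset F) fun i j => ?_
      rw [clopenFun_of_notMem (by simp), clopenFun_of_notMem (by simp)]
  refine ⟨φ, ⟨fun i j h => ?_, s.d, fun i => φ i - s.d • dirac (limPt A (ξ, i)), ?_, fun i j => ?_,
    fun i => ?_⟩, fun i => ?_⟩
  · simpa using limPt_injective h
  · exact ge_of_tendsto (hs.atom 0).abs (Eventually.of_forall hc)
  · dsimp only
    rw [heq i j, sub_self, norm_zero]
    exact (half_pos hc0).le
  · exact (add_sub_cancel _ _).symm
  · refine mem_closure_of_tendsto ((continuous_subtype_val.tendsto _).comp (hl i)) ?_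
    filter_upwards [hs.mem i] with k hk
    exact ⟨k, Set.mem_iUnion.2 ⟨i, hk⟩, rfl⟩

/-- Countably many real sequences control the convergence of a sequence in `M₁(𝔸(ι))`. -/
theorem exists_controlling_sequences {ι : Type} [TopologicalSpace ι] [DiscreteTopology ι]
    (lam : ℕ → MBall (OnePoint ι)) :
    ∃ a : ℕ → ℕ → ℝ, (∀ k j, |a k j| ≤ 1) ∧ ∀ (F : Filter ℕ) [F.NeBot],
      (∀ j, ∃ l, Tendsto (fun k => a k j) F (𝓝 l)) → ∃ l, Tendsto lam F (𝓝 l) := by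
  classical
  have hnorm : ∀ W : TopologicalSpace.Clopens (OnePoint ι), ‖clopenFun W‖ ≤ 1 := fun W => by
    refine (ContinuousMap.norm_le _ zero_le_one).2 fun x => ?_
    by_cases hx : x ∈ W
    · simp [clopenFun_of_mem hx]
    · simp [clopenFun_of_notMem hx]
  have hcount : ∀ k, {ξ : ι | (lam k).1 (clopenFun (pointClopen ξ)) ≠ 0}.Countable := fun k => by
    refine countable_support (fun ξ : ι => clopenFun (pointClopen ξ)) (fun F s hs => ?_)
      (WeakDual.toStrongDual (lam k).1)
    refine (ContinuousMap.norm_le _ zero_le_one).2 fun x => ?_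
    rw [ContinuousMap.sum_apply]
    induction x using OnePoint.rec with
    | infty =>
      rw [Finset.sum_eq_zero fun ξ _ => ?_, norm_zero]
      · exact zero_le_one
      · rw [ContinuousMap.smul_apply, clopenFun_of_notMem (by simp), smul_zero]
    | coe ζ =>
      have : ∀ ξ, (s ξ • clopenFun (pointClopen ξ)) (ζ : OnePoint ι) = if ζ = ξ then s ξ else 0 := by
        intro ξ
        by_cases h : ζ = ξ
        · rw [ContinuousMap.smul_apply, clopenFun_of_mem (by simp [h]), if_pos h, smul_eq_mul, mul_one]
        · rw [ContinuousMap.smul_apply, clopenFun_of_notMem (by simpa using h), if_neg h, smul_zero]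
      simp only [this, Finset.sum_ite_eq]
      split_ifs
      · exact hs ζ
      · simp
  set T : Set ι := ⋃ k, {ξ | (lam k).1 (clopenFun (pointClopen ξ)) ≠ 0} with hT
  have hTc : T.Countable := Set.countable_iUnion hcount
  obtain ⟨W, hW⟩ := (((Set.countable_singleton _).insert _).union (hTc.image pointClopen)
    : ({⊤, ⊥} ∪ pointClopen '' T : Set (TopologicalSpace.Clopens (OnePoint ι))).Countable
    ).exists_eq_range ⟨⊤, Or.inl (Or.inl rfl)⟩
  refine ⟨fun k j => (lam k).1 (clopenFun (W j)), fun k j => ?_, fun F _ hF => ?_⟩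
  · refine ((WeakDual.toStrongDual (lam k).1).le_opNorm _).trans ?_
    exact mul_le_one₀ (lam k).2 (norm_nonneg _) (hnorm _)
  · have hmem : ∀ V ∈ ({⊤, ⊥} ∪ pointClopen '' T : Set (TopologicalSpace.Clopens (OnePoint ι))),
        ∃ L, Tendsto (fun k => (lam k).1 (clopenFun V)) F (𝓝 L) := by
      intro V hV
      rw [hW] at hV
      obtain ⟨j, rfl⟩ := hV
      exact hF j
    refine isTestFamily_discrete.exists_tendsto fun V hV => ?_
    rcases hV with hV | ⟨ξ, rfl⟩
    · exact hmem V (Or.inl hV)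
    · by_cases hξ : ξ ∈ T
      · exact hmem _ (Or.inr ⟨ξ, hξ, rfl⟩)
      · refine ⟨0, tendsto_const_nhds.congr fun k => ?_⟩
        by_contra h
        exact hξ (Set.mem_iUnion.2 ⟨k, fun h' => h h'.symm⟩)

theorem exists_isAdmissible (hpc : pNumber = 𝔠) (ι : Type) [TopologicalSpace ι]
    [DiscreteTopology ι] (hι : #ι = 𝔠) : ∃ A : ι × Fin 3 → Set ℕ, IsAdmissible A := by
  have h0 : ℵ₀ < pNumber := hpc ▸ aleph0_lt_continuum
  -- An enumeration of all tasks along `ι`.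
  let R : Type := (ℕ → {m : lp (fun _ : ℕ => ℝ) 1 // ‖m‖ ≤ 1}) × (ℕ → ℕ → Set.Icc (-1 : ℝ) 1)
  have hRc : #R ≤ #ι := by
    have h1 : #R ≤ #((ℕ → ℕ → ℝ) × (ℕ → ℕ → ℝ)) := by
      refine mk_le_of_injective (f := fun p => (fun k n => (p.1 k).1 n, fun k n => (p.2 k n).1)) ?_
      rintro ⟨m, a⟩ ⟨m', a'⟩ h
      rw [Prod.mk.injEq] at h
      refine Prod.ext (funext fun k => Subtype.ext (lp.ext (congrFun h.1 k)))
        (funext fun k => funext fun n => Subtype.ext (congrFun (congrFun h.2 k) n))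
    refine h1.trans_eq ?_
    simp [hι, mk_real]
  have hRne : Nonempty R := ⟨fun _ => ⟨0, by simp⟩, fun _ _ => ⟨0, by simp⟩⟩
  obtain ⟨emb⟩ : Nonempty (R ↪ ι) := hRc
  let task : ι → R := Function.invFun emb
  have htask : Function.Surjective task := Function.invFun_surjective emb.injective
  obtain ⟨r, hwo, hr⟩ := exists_ord_eq ι
  have hinit : ∀ ξ, #{η // r η ξ} < pNumber := fun ξ => by
    have h1 : Ordinal.typein r ξ < ord #ι := hr ▸ Ordinal.typein_lt_type r ξ
    rw [lt_ord] at h1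
    rw [hpc, ← hι]
    exact h1
  let f : ι → ℕ → ℕ → ℝ := fun ξ k => ((task ξ).1 k).1
  let a : ι → ℕ → ℕ → ℝ := fun ξ k j => ((task ξ).2 k j).1
  have : Nonempty Step := ⟨⟨fun _ => ∅, id, fun _ => default, 0⟩⟩
  obtain ⟨F, hF⟩ := exists_of_wellFounded (T := Step) (r := r) hwo.wf
    (fun ξ s => s.IsGood (f ξ) (a ξ)) (fun ξ s e => s.Follows e (f ξ)) fun ξ F hF =>
      exists_step (fun k => (summable_abs_lp _).of_abs)
        (fun k => (tsum_abs_lp _).trans_le ((task ξ).1 k).2) (fun k j => abs_le.2 ((task ξ).2 k j).2)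
        h0 (hinit ξ) F fun η i => (hF η).thin i
  let A : ι × Fin 3 → Set ℕ := fun p => (F p.1).C p.2
  have hA : ∀ j k, j ≠ k → (A j ∩ A k).Finite := by
    rintro ⟨ξ, i⟩ ⟨η, j⟩ hne
    rcases trichotomous_of r ξ η with h | rfl | h
    · rw [Set.inter_comm]
      exact ((hF η).2 ξ h).finite j i
    · have hij : i ≠ j := fun h => hne (h ▸ rfl)
      rw [((hF ξ).1.disjoint i j hij).inter_eq]
      exact Set.finite_empty
    · exact ((hF ξ).2 η h).finite i j
  refine ⟨A, ⟨fun j => (hF j.1).1.infinite j.2, hA, ?_⟩⟩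
  intro c hc0 _ μ hμ hc lam
  obtain ⟨b, hb, hlam⟩ := exists_controlling_sequences lam
  obtain ⟨ξ, hξ⟩ := htask (fun k => ⟨μ k, hμ k⟩, fun k j => ⟨b k j, abs_le.1 (hb k j)⟩)
  have hfξ : f ξ = fun k => ⇑(μ k) := by
    funext k
    simp only [f, hξ]
  have haξ : a ξ = b := by
    funext k j
    simp only [a, hξ]
  have hgood : (F ξ).IsGood (fun k => μ k) b := by
    have := (hF ξ).1
    rwa [hfξ, haξ] at this
  have hNinf : (⋃ i, (F ξ).C i).Infinite := (hgood.infinite 0).mono (Set.subset_iUnion _ 0)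
  have hne : (atTop ⊓ 𝓟 (⋃ i, (F ξ).C i)).NeBot := by
    rw [← frequently_mem_iff_neBot, Nat.frequently_atTop_iff_infinite]
    exact hNinf
  refine ⟨⋃ i, (F ξ).C i, hNinf, hlam _ hgood.convergent, ξ, ?_⟩
  refine exists_fork hA hμ hc0 hc hgood ξ (fun i => rfl) fun η i hη => ?_
  rcases trichotomous_of r ξ η with h | rfl | h
  · exact hgood.same_sparse _ (((hF η).2 ξ h).sparse i)
  · exact absurd rfl hη
  · have := ((hF ξ).2 η h).same i
    rwa [hfξ] at this

/-! ### `C(𝔸(ι))` and `c₀(ι)` -/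

section Iso

variable {ι : Type} [TopologicalSpace ι]

theorem c0_norm_le_iff {h : C₀(ι, ℝ)} {M : ℝ} (hM : 0 ≤ M) : ‖h‖ ≤ M ↔ ∀ ξ, |h ξ| ≤ M := by
  rw [← ZeroAtInftyContinuousMap.norm_toBCF_eq_norm, BoundedContinuousFunction.norm_le hM]
  rfl

theorem c0_abs_apply_le (h : C₀(ι, ℝ)) (ξ : ι) : |h ξ| ≤ ‖h‖ :=
  (c0_norm_le_iff (norm_nonneg h)).1 le_rfl ξ

variable [DiscreteTopology ι]

theorem tendsto_cofinite_infty (g : C(OnePoint ι, ℝ)) :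
    Tendsto (fun ξ : ι => g ξ) cofinite (𝓝 (g OnePoint.infty)) := by
  have h : Tendsto ((↑) : ι → OnePoint ι) cofinite (𝓝 OnePoint.infty) := by
    rw [← cocompact_eq_cofinite, ← coclosedCompact_eq_cocompact]
    exact OnePoint.tendsto_coe_infty
  exact (g.continuous.tendsto _).comp h

/-- A function on a discrete space tending to zero, as an element of `c₀`. -/
def c0OfTendsto (f : ι → ℝ) (hf : Tendsto f cofinite (𝓝 0)) : C₀(ι, ℝ) where
  toFun := f
  continuous_toFun := continuous_of_discreteTopology
  zero_at_infty' := by rwa [cocompact_eq_cofinite]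

@[simp] theorem c0OfTendsto_apply (f : ι → ℝ) (hf : Tendsto f cofinite (𝓝 0)) (ξ : ι) :
    c0OfTendsto f hf ξ = f ξ := rfl

theorem tendsto_cofinite_zero (h : C₀(ι, ℝ)) : Tendsto h cofinite (𝓝 0) := by
  rw [← cocompact_eq_cofinite]
  exact h.zero_at_infty'

/-- The values `g ∞` and `g ξ - g ∞` of `g ∈ C(𝔸(ι))`, arranged along `ι ≃ ι ∪ {none}`. -/
theorem tendsto_rearranged (e : ι ≃ Option ι) (g : C(OnePoint ι, ℝ)) :
    Tendsto (fun ξ => (e ξ).elim (g OnePoint.infty) fun η => g η - g OnePoint.infty)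
      cofinite (𝓝 0) := by
  have h1 : Tendsto (fun o : Option ι => o.elim (g OnePoint.infty) fun η => g η - g OnePoint.infty)
      cofinite (𝓝 0) := by
    intro s hs
    have h2 : Tendsto (fun ξ : ι => g ξ - g OnePoint.infty) cofinite (𝓝 0) := by
      simpa using (tendsto_cofinite_infty g).sub_const (g OnePoint.infty)
    refine mem_cofinite.2 (((mem_cofinite.1 (h2 hs)).image some).insert none |>.subset ?_)
    rintro (_ | η) ho
    · exact Or.inl rfl
    · exact Or.inr ⟨η, ho, rfl⟩
  exact h1.comp e.injective.tendsto_cofinite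

/-- `C(𝔸(ι))` and `c₀(ι)` are isomorphic for infinite `ι`. -/
theorem nonempty_iso [Infinite ι] : Nonempty (Iso C(OnePoint ι, ℝ) C₀(ι, ℝ)) := by
  obtain ⟨e⟩ : Nonempty (ι ≃ Option ι) := by
    rw [← Cardinal.eq, mk_option]
    exact (add_one_eq (aleph0_le_mk ι)).symm
  let back : C₀(ι, ℝ) → C(OnePoint ι, ℝ) := fun h =>
    { toFun := fun x => h (e.symm none) + x.elim 0 fun η => h (e.symm (some η))
      continuous_toFun := by
        refine continuous_const.add (continuous_iff_continuousAt.2 fun x => ?_)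
        induction x using OnePoint.rec with
        | infty =>
          rw [OnePoint.continuousAt_infty', coclosedCompact_eq_cocompact, cocompact_eq_cofinite]
          exact (tendsto_cofinite_zero h).comp
            (e.symm.injective.comp (Option.some_injective ι)).tendsto_cofinite
        | coe η =>
          rw [OnePoint.continuousAt_coe]
          exact continuous_of_discreteTopology.continuousAt }
  let T : C(OnePoint ι, ℝ) ≃ₗ[ℝ] C₀(ι, ℝ) :=
    { toFun := fun g => c0OfTendsto _ (tendsto_rearranged e g)
      map_add' := fun g g' => by
        ext ξ
        rw [ZeroAtInftyContinuousMap.add_apply]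
        simp only [c0OfTendsto_apply]
        rcases e ξ with _ | η
        · rfl
        · exact add_sub_add_comm _ _ _ _
      map_smul' := fun c g => by
        ext ξ
        rw [ZeroAtInftyContinuousMap.smul_apply]
        simp only [c0OfTendsto_apply]
        rcases e ξ with _ | η
        · rfl
        · exact (mul_sub c _ _).symm
      invFun := back
      left_inv := fun g => by
        ext x
        induction x using OnePoint.rec with
        | infty => simp [back]
        | coe η => simp [back]
      right_inv := fun h => by
        ext ξ
        obtain ⟨o, rfl⟩ := e.symm.surjective ξ
        rcases o with _ | η
        · simp [back]
        · simp [back] }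
  refine ⟨T.toContinuousLinearEquivOfBounds 2 2 (fun g => ?_) fun h => ?_⟩
  · refine (c0_norm_le_iff (by positivity)).2 fun ξ => ?_
    have h1 := g.norm_coe_le_norm OnePoint.infty
    change |(e ξ).elim (g OnePoint.infty) fun η => g η - g OnePoint.infty| ≤ _
    rw [Real.norm_eq_abs] at h1
    rcases e ξ with _ | η
    · exact h1.trans (by linarith [norm_nonneg g])
    · have h2 := g.norm_coe_le_norm η
      exact (abs_sub _ _).trans (by rw [Real.norm_eq_abs] at h2; linarith)
  · refine (ContinuousMap.norm_le _ (by positivity)).2 fun x => ?_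
    change |h (e.symm none) + x.elim 0 fun η => h (e.symm (some η))| ≤ _
    have h1 := c0_abs_apply_le h (e.symm none)
    refine (abs_add_le _ _).trans ?_
    induction x using OnePoint.rec with
    | infty =>
      have : |(OnePoint.infty : OnePoint ι).elim 0 fun η => h (e.symm (some η))| = 0 := abs_zero
      linarith [norm_nonneg h]
    | coe η =>
      have h2 := c0_abs_apply_le h (e.symm (some η))
      have : |(η : OnePoint ι).elim 0 fun η => h (e.symm (some η))| = |h (e.symm (some η))| := rfl
      linarith

end Iso

/-! ### The space `X` and its exact sequence -/

section XSpace

variable {ι : Type} [TopologicalSpace ι] {A : ι × Fin 3 → Set ℕ}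

theorem completeSpace_xSpace (A : ι × Fin 3 → Set ℕ) : CompleteSpace (XSpace A) := by
  let q : C(Ext A, ℝ) → C(OnePoint ι, ℝ) := fun f =>
    f.comp ((⟨Ext.ball, continuous_ball A⟩ : C(_, Ext A)).comp diracMap)
  have hq : Continuous q := ContinuousMap.continuous_precomp _
  have hset : (XSpace A : Set C(Ext A, ℝ)) =
      ⋂ m : MBall (OnePoint ι), {f | f (.ball m) = m.1 (q f)} := by
    ext f
    rw [Set.mem_iInter]
    exact ⟨fun hf m => quotientMap_spec A ⟨f, hf⟩ m, fun hf => ⟨q f, hf⟩⟩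
  have hclosed : IsClosed (XSpace A : Set C(Ext A, ℝ)) := by
    rw [hset]
    refine isClosed_iInter fun m => isClosed_eq (continuous_eval_const _) ?_
    exact (WeakDual.toStrongDual m.1).continuous.comp hq
  exact hclosed.completeSpace_coe

/-- The restriction of a function on `L` to `K_𝒜`. -/
noncomputable def restrictAU (f : C(Ext A, ℝ)) : C(AUSpace A, ℝ) :=
  f.comp ⟨fun x => glue A (Sum.inr x), (continuous_glue A).comp continuous_inr⟩

theorem quotientMap_eq_zero_iff (f : XSpace A) :
    quotientMap A f = 0 ↔ ∀ m, f.1 (.ball m) = 0 := by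
  refine ⟨fun h m => ?_, fun h => ?_⟩
  · rw [quotientMap_spec, h, map_zero]
  · ext x
    exact h _

/-- A continuous function on `K_𝒜` that vanishes off `ω` tends to zero on `ω`. -/
theorem tendsto_natPt_zero {J : Type} {A : J → Set ℕ} (f : C(AUSpace A, ℝ))
    (hinf : f OnePoint.infty = 0) (hlim : ∀ j, f (limPt A j) = 0) :
    Tendsto (fun n => f (natPt A n)) cofinite (𝓝 0) := by
  rw [Metric.tendsto_nhds]
  intro ε hε
  -- The sets `{natPt n}`, for all `n`, and `{|f| < ε}` form an open cover of `K_𝒜`.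
  have hU : IsOpen {x : AUSpace A | dist (f x) 0 < ε} :=
    isOpen_lt (f.continuous.dist continuous_const) continuous_const
  obtain ⟨t, ht⟩ := isCompact_univ.elim_finite_subcover
    (fun o : Option ℕ => o.elim {x : AUSpace A | dist (f x) 0 < ε} fun n => finClopen A {n})
    (by
      rintro (_ | n)
      · exact hU
      · exact (finClopen A {n}).isOpen)
    (by
      intro x _
      rw [Set.mem_iUnion]
      induction x using AUSpace.cases with
      | infty => exact ⟨none, by simpa [hinf] using hε⟩
      | nat n => exact ⟨some n, natPt_mem_finClopen.2 (Finset.mem_singleton_self n)⟩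
      | lim j => exact ⟨none, by simpa [hlim] using hε⟩)
  refine mem_cofinite.2 ((t.eraseNone.finite_toSet).subset fun n hn => ?_)
  have hmem := ht (Set.mem_univ (natPt A n))
  simp only [Set.mem_iUnion] at hmem
  obtain ⟨o, ho, hx⟩ := hmem
  rcases o with _ | m
  · exact absurd hx hn
  · have : n ∈ ({m} : Finset ℕ) := natPt_mem_finClopen.1 hx
    rw [Finset.mem_singleton] at this
    subst this
    simpa using ho

theorem inclusion_injective (A : ι × Fin 3 → Set ℕ) : Function.Injective (inclusion A) := by
  intro u v h
  ext n
  exact congrArg (fun f : XSpace A => f.1 (.nat n)) h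

theorem exact_inclusion_quotientMap (A : ι × Fin 3 → Set ℕ) :
    Function.Exact (inclusion A) (quotientMap A) := by
  intro f
  rw [quotientMap_eq_zero_iff]
  constructor
  · intro hf
    have ht := tendsto_natPt_zero (restrictAU f.1) (hf _) fun ⟨ξ, i⟩ => hf _
    refine ⟨c0OfTendsto _ ht, Subtype.ext (ContinuousMap.ext fun x => ?_)⟩
    rcases x with m | n
    · exact (hf m).symm
    · rfl
  · rintro ⟨u, rfl⟩ m
    rfl

/-- Every `g ∈ C(𝔸(ι))`, as a function on `M₁(𝔸(ι))`, extends to `L`: by Tietze's theorem applied to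
`K_𝒜` and the closed set of its non-isolated points. -/
theorem quotientMap_surjective [DiscreteTopology ι] (hA : ∀ j k, j ≠ k → (A j ∩ A k).Finite) :
    Function.Surjective (quotientMap A) := by
  intro g
  have := AUSpace.normalSpace hA
  let Z : Set (AUSpace A) := (Set.range (natPt A))ᶜ
  have hZ : IsClosed Z := by
    rw [isClosed_compl_iff]
    have : Set.range (natPt A) = ⋃ n, (finClopen A {n} : Set (AUSpace A)) := by
      ext x
      rw [Set.mem_iUnion]
      constructor
      · rintro ⟨n, rfl⟩
        exact ⟨n, natPt_mem_finClopen.2 (Finset.mem_singleton_self n)⟩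
      · rintro ⟨n, hx⟩
        induction x using AUSpace.cases with
        | infty => exact absurd hx infty_notMem_finClopen
        | nat m => exact ⟨m, rfl⟩
        | lim j => exact absurd hx limPt_notMem_finClopen
    rw [this]
    exact isOpen_iUnion fun n => (finClopen A {n}).isOpen
  -- The prescribed values on `Z`, extended by `0`.
  let w : ι × Fin 3 → ℝ := fun j => (![zeroPt ι, sigmaPt j.1, negSigmaPt j.1] j.2).1 g
  let v : AUSpace A → ℝ := fun x => x.elim 0 fun y =>
    match y with
    | .nat _ => 0
    | .lim j => w j
  have hw : ∀ ε > 0, {j | ε ≤ |w j|}.Finite := by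
    intro ε hε
    have h1 : Tendsto (fun ξ : ι => |(1 / 2 : ℝ) * (g ξ - g OnePoint.infty)|) cofinite (𝓝 0) := by
      simpa using (((tendsto_cofinite_infty g).sub_const (g OnePoint.infty)).const_mul
        (1 / 2 : ℝ)).abs
    have h2 := mem_cofinite.1 (h1.eventually (gt_mem_nhds hε))
    refine (h2.prod (Set.finite_univ (α := Fin 3))).subset ?_
    rintro ⟨ξ, i⟩ hj
    refine ⟨not_lt.2 (le_trans (show ε ≤ |w (ξ, i)| from hj) ?_), Set.mem_univ _⟩
    have h0 : w (ξ, 0) = 0 := rfl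
    have h1 : w (ξ, 1) = (1 / 2 : ℝ) * (g ξ - g OnePoint.infty) := rfl
    have h2 : w (ξ, 2) = -((1 / 2 : ℝ) * (g ξ - g OnePoint.infty)) := rfl
    fin_cases i
    · exact (congrArg abs h0).trans_le (abs_zero.trans_le (abs_nonneg _))
    · exact (congrArg abs h1).le
    · exact ((congrArg abs h2).trans (abs_neg _)).le
  have hv : ContinuousOn v Z := by
    intro x hx
    induction x using AUSpace.cases with
    | nat n => exact absurd ⟨n, rfl⟩ hx
    | lim j =>
      refine (tendsto_const_nhds (x := w j)).congr' ?_
      filter_upwards [self_mem_nhdsWithin, nhdsWithin_le_nhds ((limClopen hA j).isOpen.mem_nhds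
        (limPt_mem_limClopen.2 rfl))] with y hyZ hy
      induction y using AUSpace.cases with
      | infty => exact absurd hy infty_notMem_limClopen
      | nat n => exact absurd ⟨n, rfl⟩ hyZ
      | lim k =>
        obtain rfl : k = j := limPt_mem_limClopen.1 hy
        rfl
    | infty =>
      change Tendsto v _ (𝓝 0)
      rw [Metric.tendsto_nhds]
      intro ε hε
      have hopen : IsOpen (⋂ j ∈ {j | ε ≤ |w j|}, (limClopen hA j : Set (AUSpace A))ᶜ) :=
        (hw ε hε).isOpen_biInter fun j _ => (limClopen hA j).isClosed.isOpen_compl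
      filter_upwards [self_mem_nhdsWithin, nhdsWithin_le_nhds (hopen.mem_nhds
        (Set.mem_iInter₂.2 fun j _ => infty_notMem_limClopen))] with y hyZ hy
      rw [Real.dist_eq, sub_zero]
      induction y using AUSpace.cases with
      | infty => exact abs_zero.trans_lt hε
      | nat n => exact absurd ⟨n, rfl⟩ hyZ
      | lim k =>
        by_contra hk
        exact Set.mem_iInter₂.1 hy k (not_lt.1 hk) (limPt_mem_limClopen.2 rfl)
  obtain ⟨h, hh⟩ := ContinuousMap.exists_restrict_eq hZ ⟨Z.domRestrict v, hv.domRestrict⟩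
  have hhv : ∀ x ∈ Z, h x = v x := fun x hx => DFunLike.congr_fun hh ⟨x, hx⟩
  let f : Ext A → ℝ := fun x =>
    match x with
    | .ball m => m.1 g
    | .nat n => h (natPt A n)
  have hf : Continuous f := by
    refine continuous_coinduced_dom.2 (continuous_sum_dom.2 ⟨continuous_ball_eval g, ?_⟩)
    refine h.continuous.congr fun x => ?_
    induction x using AUSpace.cases with
    | infty =>
      exact hhv _ (by
        rintro ⟨n, hn⟩
        exact OnePoint.coe_ne_infty _ hn)
    | nat n => rfl
    | lim j =>
      exact hhv _ (by
        rintro ⟨n, hn⟩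
        exact natPt_ne_limPt hn)
  refine ⟨⟨⟨f, hf⟩, g, fun m => rfl⟩, ?_⟩
  ext x
  rfl

end XSpace

/-! ### Singularity -/

section Singular

variable {ι Γ : Type} [TopologicalSpace ι] {A : ι × Fin 3 → Set ℕ}

/-- If `f ∈ X` vanishes on `ω`, then the corresponding `g ∈ C(𝔸(ι))` is constant, as the points
`σ_ξ` are in the closure of `ω`. -/
theorem quotientMap_eq_of_nat_eq_zero (hinf : ∀ j, (A j).Infinite) (f : XSpace A)
    (hf : ∀ n, f.1 (.nat n) = 0) (x : OnePoint ι) :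
    quotientMap A f x = quotientMap A f OnePoint.infty := by
  induction x using OnePoint.rec with
  | infty => rfl
  | coe ξ =>
    have : Infinite (A (ξ, 1)) := (hinf (ξ, 1)).to_subtype
    have h1 : Tendsto (fun n : A (ξ, 1) => restrictAU f.1 (natPt A n)) cofinite
        (𝓝 (restrictAU f.1 (limPt A (ξ, 1)))) :=
      ((restrictAU f.1).continuous.tendsto _).comp (tendsto_natPt _)
    have h2 : restrictAU f.1 (limPt A (ξ, 1)) = 0 :=
      tendsto_nhds_unique h1 (tendsto_const_nhds.congr fun n => (hf n).symm)
    have h3 : f.1 (.ball (sigmaPt ξ)) = 0 := h2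
    rw [quotientMap_spec] at h3
    have h4 : (1 / 2 : ℝ) * (quotientMap A f ξ - quotientMap A f OnePoint.infty) = 0 := h3
    linarith

/-- The space `X` embeds into `ℓ∞ ⊕ ℝ`, so that it contains no `c₀(Γ)` with `Γ` uncountable. -/
theorem not_injective_c0 [TopologicalSpace Γ] [DiscreteTopology Γ] (hΓ : Uncountable Γ)
    (hinf : ∀ j, (A j).Infinite) (E : Op C₀(Γ, ℝ) (XSpace A)) : ¬ Function.Injective E := by
  classical
  intro hE
  let u : Γ → C₀(Γ, ℝ) := fun γ => c0OfTendsto (Pi.single γ 1 : Γ → ℝ) (by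
    refine tendsto_const_nhds.congr' ?_
    filter_upwards [(Set.finite_singleton γ).compl_mem_cofinite] with γ' hγ'
    have h : γ' ≠ γ := hγ'
    simp [h])
  have hu : ∀ (F : Finset Γ) (s : Γ → ℝ), (∀ γ, |s γ| ≤ 1) → ‖∑ γ ∈ F, s γ • u γ‖ ≤ 1 := by
    intro F s hs
    refine (c0_norm_le_iff zero_le_one).2 fun γ => ?_
    have : (∑ γ' ∈ F, s γ' • u γ') γ = if γ ∈ F then s γ else 0 := by
      have hev : ∀ G : Finset Γ, (∑ γ' ∈ G, s γ' • u γ') γ = ∑ γ' ∈ G, (s γ' • u γ') γ := fun G => by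
        induction G using Finset.induction_on with
        | empty => rfl
        | insert a G ha ih =>
          rw [Finset.sum_insert ha, Finset.sum_insert ha, ZeroAtInftyContinuousMap.add_apply, ih]
      have hval : ∀ γ', (s γ' • u γ') γ = if γ = γ' then s γ' else 0 := fun γ' => by
        rw [ZeroAtInftyContinuousMap.smul_apply, c0OfTendsto_apply, Pi.single_apply, smul_eq_mul,
          mul_ite, mul_one, mul_zero]
      rw [hev, Finset.sum_congr rfl fun γ' _ => hval γ', Finset.sum_ite_eq]
    rw [this]
    split_ifs
    · exact hs γ
    · simp
  let ev : ℕ → C₀(Γ, ℝ) →L[ℝ] ℝ := fun n =>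
    (ContinuousMap.evalCLM ℝ (Ext.nat n : Ext A)).comp ((XSpace A).subtypeL.comp E)
  have hcount : (⋃ n, {γ | ev n (u γ) ≠ 0}).Countable :=
    Set.countable_iUnion fun n => countable_support u hu (ev n)
  have hbig : (⋃ n, {γ | ev n (u γ) ≠ 0})ᶜ.Infinite := fun hfin =>
    not_countable_iff.2 hΓ (Set.countable_univ_iff.1 (by
      rw [← Set.union_compl_self (⋃ n, {γ | ev n (u γ) ≠ 0})]
      exact hcount.union hfin.countable))
  obtain ⟨γ, hγ, γ', hγ', hne⟩ := hbig.nontrivial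
  have hzero : ∀ γ ∈ (⋃ n, {γ | ev n (u γ) ≠ 0})ᶜ, ∀ n, (E (u γ)).1 (.nat n) = 0 := by
    intro γ hγ n
    by_contra h
    exact hγ (Set.mem_iUnion.2 ⟨n, h⟩)
  -- A suitable combination of the two unit vectors is mapped to `0`.
  set c := quotientMap A (E (u γ)) OnePoint.infty with hc
  set c' := quotientMap A (E (u γ')) OnePoint.infty with hc'
  have hcomb : E (c' • u γ - c • u γ') = 0 := by
    have hnat : ∀ n, (E (c' • u γ - c • u γ')).1 (.nat n) = 0 := by
      intro n
      have : (E (c' • u γ - c • u γ')).1 (.nat n) =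
          c' * (E (u γ)).1 (.nat n) - c * (E (u γ')).1 (.nat n) := by
        rw [map_sub, map_smul, map_smul]
        rfl
      rw [this, hzero γ hγ n, hzero γ' hγ' n, mul_zero, mul_zero, sub_zero]
    have hq : quotientMap A (E (c' • u γ - c • u γ')) = 0 := by
      ext x
      rw [quotientMap_eq_of_nat_eq_zero hinf _ hnat, map_sub, map_sub, map_smul, map_smul, map_smul,
        map_smul]
      change c' * c - c * c' = 0
      ring
    rw [quotientMap_eq_zero_iff] at hq
    refine Subtype.ext (ContinuousMap.ext fun x => ?_)
    rcases x with m | n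
    · exact hq m
    · exact hnat n
  have hv := (map_eq_zero_iff E hE).1 hcomb
  have hval : ∀ δ, c' * (Pi.single γ 1 : Γ → ℝ) δ - c * (Pi.single γ' 1 : Γ → ℝ) δ = 0 :=
    fun δ => congrArg (fun h : C₀(Γ, ℝ) => h δ) hv
  have hc'0 : c' = 0 := by simpa [hne] using hval γ
  have hc0 : c = 0 := by simpa [hne.symm] using hval γ'
  have hker : E (u γ) = 0 := by
    have hq : quotientMap A (E (u γ)) = 0 := by
      ext x
      rw [quotientMap_eq_of_nat_eq_zero hinf _ (hzero γ hγ)]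
      exact hc0
    rw [quotientMap_eq_zero_iff] at hq
    refine Subtype.ext (ContinuousMap.ext fun x => ?_)
    rcases x with m | n
    · exact hq m
    · exact hzero γ hγ n
  have hone := congrArg (fun h : C₀(Γ, ℝ) => h γ) ((map_eq_zero_iff E hE).1 hker)
  have : (Pi.single γ 1 : Γ → ℝ) γ = 0 := hone
  simp at this

end Singular

end TwistedSum


theorem proposition5p2 (hpc : pNumber = 𝔠)
    (ι : Type) [TopologicalSpace ι] [DiscreteTopology ι] (hι : #ι = 𝔠)
    (Γ : Type) [TopologicalSpace Γ] [DiscreteTopology Γ] (hΓ : #Γ = ℵ₁) :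
    Nonempty (Iso C(OnePoint ι, ℝ) C₀(ι, ℝ)) ∧
    (∃ A : ι × Fin 3 → Set ℕ, IsAdmissible A) ∧
    ∀ A : ι × Fin 3 → Set ℕ, IsAdmissible A →
      CompleteSpace (XSpace A) ∧
      ∀ Φ : Iso C(OnePoint ι, ℝ) C₀(ι, ℝ),
        IsShortExact (inclusion A) (quotientMapC0 A Φ) ∧
        IsC0Singular Γ (quotientMapC0 A Φ) ∧
        ¬ ∃ (J : Op C₀(Γ, ℝ) C₀(ι, ℝ)) (E : Op C₀(Γ, ℝ) (XSpace A)),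
          IsEmbedding J ∧ ∀ x, quotientMapC0 A Φ (E x) = J x := by
  have : Infinite ι := infinite_iff.2 (hι ▸ aleph0_le_continuum)
  have hΓu : Uncountable Γ := by
    rw [← aleph0_lt_mk_iff, hΓ]
    exact aleph0_lt_aleph_one
  refine ⟨nonempty_iso, exists_isAdmissible hpc ι hι, fun A hA =>
    ⟨completeSpace_xSpace A, fun Φ => ⟨⟨inclusion_injective A, fun f => ?_,
      Φ.surjective.comp (quotientMap_surjective hA.almostDisjoint)⟩, ?_, ?_⟩⟩⟩
  · rw [← exact_inclusion_quotientMap A f]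
    exact map_eq_zero_iff Φ Φ.injective
  · rintro Y ⟨e⟩ -
    exact not_injective_c0 hΓu hA.infinite (Y.subtypeL.comp (e : C₀(Γ, ℝ) →L[ℝ] Y))
      (Subtype.val_injective.comp e.injective)
  · rintro ⟨J, E, hJ, hE⟩
    refine not_injective_c0 hΓu hA.infinite E (Function.Injective.of_comp (f := quotientMapC0 A Φ) ?_)
    rw [show ⇑(quotientMapC0 A Φ) ∘ ⇑E = J from funext hE]
    exact hJ.injective
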